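/- Let $0<p<1$ and let $\Omega=(-1,1)$. Fix $K\ge 1$ data points $x_1,\dots,x_K\in\mathbb R$, encoder mapping points $\alpha_1<\dots<\alpha_K$ in $\Omega$ and, for every number $N$ of servers, decoder mapping points $\beta_1<\dots<\beta_N$ in $\Omega$ (depending on $N$). With $\beta_0:=-1$, $\beta_{N+1}:=1$, $\Delta_{\max}:=\max_{0\le n\le N}(\beta_{n+1}-\beta_n)$ and $\Delta_{\min}:=\min_{1\le n\le N-1}(\beta_{n+1}-\beta_n)$, assume that $\Delta_{\max}/\Delta_{\min}\le B$ for a constant $B>0$ and all $N\ge 2$. Each server is a straggler with probability $p$, independently of the others; $\mathcal F\subseteq\{1,\dots,N\}$ denotes the random set of non-stragglers. For a function $f:\mathbb R\to\mathbb R$, an encoder $u_{\rm enc}$ and decoder functions $u_{{\rm dec},\mathcal F}$, computed from the results $f(u_{\rm enc}(\beta_v))$, $v\in\mathcal F$, let $$\ell_N(\mathcal F):=\frac1K\sum_{k=1}^K\bigl(u_{{\rm dec},\mathcal F}(\alpha_k)-f(x_k)\bigr)^2 ,\qquad \mathcal L_N:=\mathbb E_{\mathcal F}[\ell_N(\mathcal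 F)].$$ (LeTCC) Let $f$ be Lipschitz and twice differentiable with bounded second derivative, let $u_{\rm enc}$ be a natural cubic spline with knots $\alpha_1,\dots,\alpha_K$ and $u_{\rm enc}(\alpha_k)=x_k$ for all $k$, and let $0\le\lambda_N\le N^{-4}$. For $\mathcal F\ne\emptyset$ let $u_{{\rm dec},\mathcal F}$ be a minimizer over the Sobolev space $H^2(\Omega)$ of $$u\mapsto\frac1{|\mathcal F|}\sum_{v\in\mathcal F}\bigl(u(\beta_v)-f(u_{\rm enc}(\beta_v))\bigr)^2+\lambda_N\int_\Omega u''(t)^2\,dt$$ (if $\lambda_N=0$: a minimizer for which $\int_\Omega (u'')^2$ is least). Then $\ell_N$ converges to zero with high probability at the rate $\log_{1/p}^3(N)/N^3$: for every $\varepsilon>0$, $\Pr(\ell_N\le\varepsilon)\to1$, and there is a constant $C$ such that for every $\delta\in(0,1)$ there is $n_0$ with $$\Pr\Bigl(\ell_N\le C\,\frac{\log_{1/p}^3(N)}{N^3}\Bigr)\ge 1-\delta\qquad\text{for all }N>n_0 .$$ If moreover the values $u_{{\rm dec},\mathcal F}(\alpha_k)$ for $|\mathcal F|<2$ (where the minimizer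 is not unique or not defined) are chosen bounded by a constant independent of $N$, then $\mathcal L_N\to0$ and $\mathcal L_N=O\bigl(\log_{1/p}^3(N)/N^3\bigr)$. (BACC) Let $f\in C^2(\mathbb R)$, let $u_{\rm enc}$ be Berrut's rational interpolant of the data $(\alpha_k,x_k)$, $1\le k\le K$, and let $u_{{\rm dec},\mathcal F}$ be Berrut's rational interpolant of the data $(\beta_v,f(u_{\rm enc}(\beta_v)))$, $v\in\mathcal F$ (and $0$ if $\mathcal F=\emptyset$). Here Berrut's interpolant of data $(t_i,y_i)$, $1\le i\le n$, $t_1<\dots<t_n$, is $z\mapsto\sum_i\frac{(-1)^i}{z-t_i}y_i\big/\sum_i\frac{(-1)^i}{z-t_i}$, with value $y_i$ at $t_i$. Then $\ell_N$ converges to zero with high probability, in the same sense, at the rate $\log_{1/p}^4(N)/N^2$; moreover $\mathcal L_N\to0$ and $\mathcal L_N=O\bigl(\log_{1/p}^4(N)/N^2\bigr)$. -/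

import Mathlib

open Filter Topology MeasureTheory

noncomputable section

namespace CodedComputing

/-- The domain `Ω = (-1, 1)`, which contains all mapping points. -/
def Omega : Set ℝ := Set.Ioo (-1) 1

/-! ### Random stragglers

The `N` servers are indexed by `Fin N`; `F : Finset (Fin N)` is the set of servers that respond. -/

/-- The probability that `F` is exactly the set of non-stragglers, when each server is a straggler
with probability `p`, independently of the others. -/
def responseWeight (p : ℝ) {N : ℕ} (F : Finset (Fin N)) : ℝ :=
  ∏ n : Fin N, if n ∈ F then 1 - p else p

/-- Expectation of `X F`, where `F` is the random set of non-stragglers. -/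
def expectation (p : ℝ) {N : ℕ} (X : Finset (Fin N) → ℝ) : ℝ :=
  ∑ F : Finset (Fin N), responseWeight p F * X F

/-- Probability that the random set of non-stragglers belongs to `A`. -/
def probability (p : ℝ) {N : ℕ} (A : Set (Finset (Fin N))) : ℝ :=
  expectation p (A.indicator fun _ => 1)

/-! ### Decoder mapping points -/

/-- The points `β₁ < ⋯ < β_N` (at positions `1, …, N`) completed by the end points of `Ω`:
`β₀ = -1` and `β_{N+1} = 1`. -/
def extendedNode {N : ℕ} (β : Fin N → ℝ) (n : ℕ) : ℝ :=
  if n = 0 then -1 else if h : n - 1 < N then β ⟨n - 1, h⟩ else 1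

/-- `Δ_max`, the largest of the `N + 1` gaps `β_{n+1} - β_n`, `0 ≤ n ≤ N`. -/
def deltaMax {N : ℕ} (β : Fin N → ℝ) : ℝ :=
  ⨆ n : Fin (N + 1), (extendedNode β (n + 1) - extendedNode β n)

/-- `Δ_min`, the smallest of the `N - 1` gaps `β_{n+1} - β_n`, `1 ≤ n ≤ N - 1`
(meaningful for `2 ≤ N`). -/
def deltaMin {N : ℕ} (β : Fin N → ℝ) : ℝ :=
  ⨅ n : Fin (N - 1), (extendedNode β (n + 2) - extendedNode β (n + 1))

/-! ### Berrut's rational interpolation (BACC) -/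

/-- The alternating sign of the node `v` among the nodes of `F`: `(-1)` to the number of elements
of `F` below `v`. -/
def alternatingSign {n : ℕ} (F : Finset (Fin n)) (v : Fin n) : ℝ :=
  (-1) ^ (F.filter (· < v)).card

open Classical in
/-- Berrut's rational interpolant of the data `(t v, y v)`, `v ∈ F`. At a node the quotient is to
be read as its limit, the datum at that node. -/
def berrut {n : ℕ} (t y : Fin n → ℝ) (F : Finset (Fin n)) (z : ℝ) : ℝ :=
  if h : ∃ v ∈ F, t v = z then y h.choose
  else (∑ v ∈ F, alternatingSign F v / (z - t v) * y v) /
    ∑ v ∈ F, alternatingSign F v / (z - t v)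

/-- The BACC encoder: the Berrut interpolant of `(α k, x k)`, for all `k`. -/
def baccEncoder {K : ℕ} (α x : Fin K → ℝ) : ℝ → ℝ :=
  berrut α x Finset.univ

/-- The BACC decoder: the Berrut interpolant of the results `f (enc (β v))`, `v ∈ F`. -/
def baccDecoder (f enc : ℝ → ℝ) {N : ℕ} (β : Fin N → ℝ) (F : Finset (Fin N)) : ℝ → ℝ :=
  berrut β (fun v => f (enc (β v))) F

/-! ### Smoothing splines (LeTCC) -/

/-- The second-order Sobolev space `H²(Ω)`, realised by its continuous representatives: `u` is
differentiable on `Ω`, `u'` is absolutely continuous and `u'' ∈ L²(Ω)`. -/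
structure MemH2 (u : ℝ → ℝ) : Prop where
  differentiableOn : DifferentiableOn ℝ u Omega
  absolutelyContinuous : ∀ a ∈ Omega, ∀ b ∈ Omega, AbsolutelyContinuousOnInterval (deriv u) a b
  memLp : MemLp (deriv (deriv u)) 2 (volume.restrict Omega)

/-- The roughness `∫_Ω (u'')²`. -/
def roughness (u : ℝ → ℝ) : ℝ := ∫ t in Omega, (deriv (deriv u) t) ^ 2

/-- The penalised least-squares objective of the LeTCC decoder. -/
def letccObjective (f enc : ℝ → ℝ) {N : ℕ} (β : Fin N → ℝ) (lam : ℝ) (F : Finset (Fin N))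
    (u : ℝ → ℝ) : ℝ :=
  (1 / (F.card : ℝ)) * ∑ v ∈ F, (u (β v) - f (enc (β v))) ^ 2 + lam * roughness u

/-- `u` minimises the LeTCC decoder objective over `H²(Ω)`. -/
def IsLetccMinimizer (f enc : ℝ → ℝ) {N : ℕ} (β : Fin N → ℝ) (lam : ℝ) (F : Finset (Fin N))
    (u : ℝ → ℝ) : Prop :=
  MemH2 u ∧ ∀ w, MemH2 w → letccObjective f enc β lam F u ≤ letccObjective f enc β lam F w

/-- `u` is a LeTCC decoder function for the responses of `F`: a minimiser of the objective. In the
non-smooth version `lam = 0`, where every interpolant is a minimiser, it is one of least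
roughness (the limit `lam → 0`). -/
def IsLetccDecoder (f enc : ℝ → ℝ) {N : ℕ} (β : Fin N → ℝ) (lam : ℝ) (F : Finset (Fin N))
    (u : ℝ → ℝ) : Prop :=
  IsLetccMinimizer f enc β lam F u ∧
    (lam = 0 → ∀ w, IsLetccMinimizer f enc β lam F w → roughness u ≤ roughness w)

/-- `u` is a natural cubic spline with knots `α₁ < ⋯ < α_K`: it is of class `C²`, a polynomial of
degree at most `3` between consecutive knots, and affine to the left of the first knot and to the
right of the last one. -/
structure IsNaturalSpline {K : ℕ} (α : Fin K → ℝ) (u : ℝ → ℝ) : Prop where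
  contDiff : ContDiff ℝ 2 u
  cubic : ∀ i j : Fin K, (j : ℕ) = i + 1 →
    ∃ P : Polynomial ℝ, P.natDegree ≤ 3 ∧ ∀ z ∈ Set.Icc (α i) (α j), u z = P.eval z
  affine_left : ∃ P : Polynomial ℝ, P.natDegree ≤ 1 ∧ ∀ z, (∀ i, z ≤ α i) → u z = P.eval z
  affine_right : ∃ P : Polynomial ℝ, P.natDegree ≤ 1 ∧ ∀ z, (∀ i, α i ≤ z) → u z = P.eval z

/-! ### Approximation error and its convergence -/

/-- The approximation error `(1/K) ∑ₖ (dec (α k) - f (x k))²` of the decoder function `dec`,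
which was computed from the responses of one set of non-stragglers. -/
def approxError {K : ℕ} (α x : Fin K → ℝ) (f dec : ℝ → ℝ) : ℝ :=
  (1 / (K : ℝ)) * ∑ k : Fin K, (dec (α k) - f (x k)) ^ 2

/-- With high probability over the stragglers, the error `err N F` tends to zero and is at most a
constant times `rate N`: for one constant `C` and every `δ ∈ (0, 1)` this holds with probability at
least `1 - δ` as soon as `N` is large. -/
def ConvergesWithHighProbability (p : ℝ) (err : (N : ℕ) → Finset (Fin N) → ℝ)
    (rate : ℕ → ℝ) : Prop :=
  (∀ ε : ℝ, 0 < ε → Tendsto (fun N => probability p {F | err N F ≤ ε}) atTop (𝓝 1)) ∧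
  ∃ C : ℝ, ∀ δ : ℝ, 0 < δ → δ < 1 → ∃ n₀ : ℕ, ∀ N : ℕ, n₀ < N →
    1 - δ ≤ probability p {F | err N F ≤ C * rate N}

/-- The expectation over the stragglers of the error `err N F` tends to zero and is `O(rate N)`. -/
def ConvergesInMean (p : ℝ) (err : (N : ℕ) → Finset (Fin N) → ℝ) (rate : ℕ → ℝ) : Prop :=
  Tendsto (fun N => expectation p (err N)) atTop (𝓝 0) ∧
  (fun N => expectation p (err N)) =O[atTop] rate

end CodedComputing

end

/-! Everything rests on one event: every window of `windowLength p N`, about `6 log_{1/p} N`,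
consecutive servers contains a non-straggler. A union bound (`probability_not_hitsWindows_le`) shows
that it fails with probability at most `N⁻⁵`. Since `Δ_max` and `Δ_min` are both of order `1/N`, on
this event each `α k` has responding nodes on both sides at distance `O(log N / N)`
(`eventually_exists_neighbours`). What remains is a deterministic error bound on the event and a
crude bound `O(N²)` off it, whose contribution to the mean is `O(N⁻³)`.

LeTCC: with `g = f ∘ enc` and `h = u - g`, using `g` as a competitor bounds `∫ (u'')²` by a constant
and each squared residual at a responding node by `O(N⁻³)`. Hence `h'` is Hölder continuous of
exponent `1/2`, and between two nodes at distance `d` one gets `h² = O(N⁻³ + d³)`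
(`sq_le_of_between`).

BACC: the error of Berrut's interpolant at `z` is an alternating sum of divided differences over an
alternating sum of reciprocals. The numerator is bounded because the divided difference is bounded
and Lipschitz in the node (`abs_alternatingSum_le`). The denominator is at least `δ / (A (A + δ))`,
where `δ` is a lower bound for the gaps and `A` an upper bound for the distance to some responding
node (`le_abs_sum_alternatingSign_div`). With `A` of order `log N / N` and `δ` of order `1/N` the
error is `O(log² N / N)`, to be squared. -/

namespace CodedComputing

/-! ### The random set of responses -/

/-- Independence in algebraic form: expanding the product gives one term per set of responses. It
yields the total mass and the probability that a given set is missed. -/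
lemma sum_prod_ite_mem {N : ℕ} (a b : Fin N → ℝ) :
    ∑ F : Finset (Fin N), ∏ n, (if n ∈ F then a n else b n) = ∏ n, (a n + b n) := by
  rw [Finset.prod_add, Finset.powerset_univ]
  refine Finset.sum_congr rfl fun F _ => ?_
  rw [Finset.prod_ite]
  congr 1
  · exact Finset.prod_congr (by ext; simp) fun _ _ => rfl
  · exact Finset.prod_congr (by ext; simp) fun _ _ => rfl

lemma sum_responseWeight (p : ℝ) (N : ℕ) : ∑ F : Finset (Fin N), responseWeight p F = 1 := by
  have := sum_prod_ite_mem (N := N) (fun _ => 1 - p) (fun _ => p)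
  simpa [responseWeight] using this

lemma responseWeight_nonneg {p : ℝ} (hp0 : 0 < p) (hp1 : p < 1) {N : ℕ} (F : Finset (Fin N)) :
    0 ≤ responseWeight p F :=
  Finset.prod_nonneg fun n _ => by split_ifs <;> linarith

lemma expectation_mono {p : ℝ} (hp0 : 0 < p) (hp1 : p < 1) {N : ℕ} {X Y : Finset (Fin N) → ℝ}
    (h : ∀ F, X F ≤ Y F) : expectation p X ≤ expectation p Y :=
  Finset.sum_le_sum fun F _ => mul_le_mul_of_nonneg_left (h F) (responseWeight_nonneg hp0 hp1 F)

lemma expectation_const (p c : ℝ) (N : ℕ) :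
    expectation p (fun _ : Finset (Fin N) => c) = c := by
  simp [expectation, ← Finset.sum_mul, sum_responseWeight]

lemma expectation_add (p : ℝ) {N : ℕ} (X Y : Finset (Fin N) → ℝ) :
    expectation p (fun F => X F + Y F) = expectation p X + expectation p Y := by
  simp [expectation, mul_add, Finset.sum_add_distrib]

lemma expectation_const_mul (p c : ℝ) {N : ℕ} (X : Finset (Fin N) → ℝ) :
    expectation p (fun F => c * X F) = c * expectation p X := by
  simp only [expectation, Finset.mul_sum]
  exact Finset.sum_congr rfl fun _ _ => by ring

lemma expectation_sum (p : ℝ) {N : ℕ} {ι : Type*} (s : Finset ι) (X : ι → Finset (Fin N) → ℝ) :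
    expectation p (fun F => ∑ i ∈ s, X i F) = ∑ i ∈ s, expectation p (X i) := by
  simp only [expectation, Finset.mul_sum]
  exact Finset.sum_comm

lemma probability_le_one {p : ℝ} (hp0 : 0 < p) (hp1 : p < 1) {N : ℕ}
    (A : Set (Finset (Fin N))) : probability p A ≤ 1 := by
  rw [← expectation_const p 1 N]
  exact expectation_mono hp0 hp1 fun F => Set.indicator_le_self' (fun _ _ => zero_le_one) F

lemma probability_mono {p : ℝ} (hp0 : 0 < p) (hp1 : p < 1) {N : ℕ}
    {A B : Set (Finset (Fin N))} (h : A ⊆ B) : probability p A ≤ probability p B :=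
  expectation_mono hp0 hp1 fun F =>
    Set.indicator_le_indicator_of_subset h (fun _ => zero_le_one) F

lemma probability_add_compl (p : ℝ) {N : ℕ} (A : Set (Finset (Fin N))) :
    probability p A + probability p Aᶜ = 1 := by
  rw [probability, probability, ← expectation_add]
  refine Eq.trans ?_ (expectation_const p 1 N)
  congr 1
  funext F
  exact congrFun (Set.indicator_self_add_compl A fun _ => (1 : ℝ)) F

/-- The probability that all servers of `W` are stragglers. -/
lemma probability_disjoint (p : ℝ) {N : ℕ} (W : Finset (Fin N)) :
    probability p {F | ∀ n ∈ W, n ∉ F} = p ^ W.card := by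
  classical
  -- A response weight of zero on `W` removes exactly the sets `F` that meet `W`.
  have h := sum_prod_ite_mem (N := N) (fun n => if n ∈ W then 0 else 1 - p) (fun _ => p)
  have h2 : ∏ n : Fin N, ((if n ∈ W then 0 else 1 - p) + p) = p ^ W.card := by
    have : ∀ n : Fin N, ((if n ∈ W then 0 else 1 - p) + p) = if n ∈ W then p else 1 := by
      intro n; split_ifs <;> ring
    simp only [this]
    rw [Finset.prod_ite_mem]
    simp
  rw [← h2, ← h, probability, expectation]
  refine Finset.sum_congr rfl fun F _ => ?_
  by_cases hF : ∀ n ∈ W, n ∉ F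
  · rw [Set.indicator_of_mem (by exact hF), mul_one, responseWeight]
    refine Finset.prod_congr rfl fun n _ => ?_
    by_cases hn : n ∈ F
    · have : n ∉ W := fun h => hF n h hn
      simp [hn, this]
    · simp [hn]
  · rw [Set.indicator_of_notMem (by exact hF), mul_zero]
    push Not at hF
    obtain ⟨n, hnW, hnF⟩ := hF
    exact (Finset.prod_eq_zero (Finset.mem_univ n) (by simp [hnW, hnF])).symm

/-- Every window of `L` consecutive servers contains a non-straggler. -/
def HitsWindows (L : ℕ) {N : ℕ} (F : Finset (Fin N)) : Prop :=
  ∀ i : ℕ, i + L ≤ N → ∃ n ∈ F, i ≤ (n : ℕ) ∧ (n : ℕ) < i + L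

/-- Union bound over the starting points of the windows; `0 < L` forces these below `N`, so there
are at most `N`. -/
lemma probability_not_hitsWindows_le {p : ℝ} (hp0 : 0 < p) (hp1 : p < 1) {L : ℕ} (hL : 0 < L)
    (N : ℕ) : probability p {F : Finset (Fin N) | ¬ HitsWindows L F} ≤ N * p ^ L := by
  classical
  let W : ℕ → Finset (Fin N) := fun i => Finset.univ.filter fun n => i ≤ (n : ℕ) ∧ (n : ℕ) < i + L
  have hcard : ∀ i, i + L ≤ N → (W i).card = L := by
    intro i hi
    have : (W i).map Fin.valEmbedding = Finset.Ico i (i + L) := by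
      ext m
      simp only [W, Finset.mem_map, Finset.mem_filter, Finset.mem_univ, true_and,
        Fin.valEmbedding_apply, Finset.mem_Ico]
      constructor
      · rintro ⟨n, hn, rfl⟩; exact hn
      · intro hm; exact ⟨⟨m, by omega⟩, hm, rfl⟩
    rw [← Finset.card_map Fin.valEmbedding, this]; simp
  let S : Finset ℕ := (Finset.range N).filter fun i => i + L ≤ N
  calc probability p {F : Finset (Fin N) | ¬ HitsWindows L F}
      ≤ expectation p (fun F => ∑ i ∈ S,
          ({F | ∀ n ∈ W i, n ∉ F} : Set (Finset (Fin N))).indicator (fun _ => (1 : ℝ)) F) := by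
        refine expectation_mono hp0 hp1 fun F => ?_
        have hnn : ∀ i ∈ S, 0 ≤ ({F | ∀ n ∈ W i, n ∉ F} : Set (Finset (Fin N))).indicator
            (fun _ => (1 : ℝ)) F := fun i _ => Set.indicator_nonneg (fun _ _ => zero_le_one) F
        by_cases hF : HitsWindows L F
        · rw [Set.indicator_of_notMem (by simpa using hF)]
          exact Finset.sum_nonneg hnn
        · rw [Set.indicator_of_mem (by exact hF)]
          rw [HitsWindows] at hF
          push Not at hF
          obtain ⟨i, hi, hiF⟩ := hF
          have hiS : i ∈ S := by simp only [S, Finset.mem_filter, Finset.mem_range]; omega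
          refine le_trans ?_ (Finset.single_le_sum hnn hiS)
          rw [Set.indicator_of_mem]
          intro n hn hnF
          simp only [W, Finset.mem_filter, Finset.mem_univ, true_and] at hn
          have := hiF n hnF hn.1
          omega
    _ = ∑ i ∈ S, p ^ L := by
        rw [expectation_sum]
        refine Finset.sum_congr rfl fun i hi => ?_
        rw [← hcard i (by simp only [S, Finset.mem_filter] at hi; exact hi.2)]
        exact probability_disjoint p (W i)
    _ ≤ N * p ^ L := by
        rw [Finset.sum_const, nsmul_eq_mul]
        refine mul_le_mul_of_nonneg_right ?_ (by positivity)
        exact_mod_cast (Finset.card_filter_le _ _).trans (Finset.card_range N).le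

/-! ### Logarithmic windows and the two modes of convergence -/

/-- The length of the windows, each of which contains a non-straggler with high probability. -/
noncomputable def windowLength (p : ℝ) (N : ℕ) : ℕ := ⌈6 * Real.logb (1 / p) N⌉₊

lemma tendsto_logb_natCast {p : ℝ} (hp0 : 0 < p) (hp1 : p < 1) :
    Tendsto (fun N : ℕ => Real.logb (1 / p) N) atTop atTop :=
  (Real.tendsto_logb_atTop (one_lt_one_div hp0 hp1)).comp tendsto_natCast_atTop_atTop

lemma windowLength_le {p : ℝ} {N : ℕ} (h : 1 ≤ Real.logb (1 / p) N) :
    (windowLength p N : ℝ) ≤ 7 * Real.logb (1 / p) N := by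
  have := Nat.ceil_lt_add_one (a := 6 * Real.logb (1 / p) N) (by linarith)
  rw [windowLength]; linarith

lemma pow_windowLength_le {p : ℝ} (hp0 : 0 < p) (hp1 : p < 1) {N : ℕ} (hN : 0 < N) :
    p ^ windowLength p N ≤ 1 / (N : ℝ) ^ 6 := by
  have hN' : (0 : ℝ) < N := by exact_mod_cast hN
  have h1 : (6 * Real.logb (1 / p) N) ≤ windowLength p N := Nat.le_ceil _
  have hp' : 0 < 1 / p := by positivity
  calc p ^ windowLength p N = p ^ (windowLength p N : ℝ) := (Real.rpow_natCast _ _).symm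
    _ ≤ p ^ (6 * Real.logb (1 / p) N) := Real.rpow_le_rpow_of_exponent_ge hp0 hp1.le h1
    _ = 1 / (N : ℝ) ^ 6 := by
        have : (1 / p) ^ Real.logb (1 / p) N = N :=
          Real.rpow_logb hp' (one_lt_one_div hp0 hp1).ne' hN'
        rw [mul_comm, Real.rpow_mul hp0.le]
        have h2 : p ^ Real.logb (1 / p) N = 1 / N := by
          rw [one_div, Real.inv_rpow hp0.le] at this
          rw [one_div, one_div, ← inv_inv (p ^ Real.logb p⁻¹ N), this]
        rw [h2]
        norm_cast
        simp

/-- The factor `6` in `windowLength` is chosen for the exponent `5` here: an error of size `N ^ 2`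
on the exceptional event then contributes only `N⁻³` to the mean. -/
lemma probability_not_hitsWindows_windowLength_le {p : ℝ} (hp0 : 0 < p) (hp1 : p < 1) {N : ℕ}
    (hN : 2 ≤ N) :
    probability p {F : Finset (Fin N) | ¬ HitsWindows (windowLength p N) F} ≤ 1 / (N : ℝ) ^ 5 := by
  have hN' : (2 : ℝ) ≤ N := by exact_mod_cast hN
  have hL : 0 < windowLength p N := by
    rw [windowLength, Nat.ceil_pos]
    have := Real.logb_pos (one_lt_one_div hp0 hp1) (by linarith : (1 : ℝ) < N)
    linarith
  refine (probability_not_hitsWindows_le hp0 hp1 hL N).trans ?_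
  calc (N : ℝ) * p ^ windowLength p N ≤ N * (1 / (N : ℝ) ^ 6) :=
        mul_le_mul_of_nonneg_left (pow_windowLength_le hp0 hp1 (by omega)) (by linarith)
    _ = 1 / (N : ℝ) ^ 5 := by field_simp

lemma tendsto_logb_pow_div_pow {p : ℝ} (hp0 : 0 < p) (hp1 : p < 1) (a : ℕ) {b : ℕ}
    (hb : 0 < b) :
    Tendsto (fun N : ℕ => Real.logb (1 / p) N ^ a / (N : ℝ) ^ b) atTop (𝓝 0) := by
  have h0 : Tendsto (fun N : ℕ => Real.log N ^ a / (N : ℝ)) atTop (𝓝 0) :=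
    (Real.isLittleO_pow_log_id_atTop (n := a)).tendsto_div_nhds_zero.comp
      tendsto_natCast_atTop_atTop
  have h1 : Tendsto (fun N : ℕ => Real.logb (1 / p) N ^ a / (N : ℝ)) atTop (𝓝 0) := by
    have := h0.div_const (Real.log (1 / p) ^ a)
    rw [zero_div] at this
    refine this.congr fun N => ?_
    rw [Real.logb, div_pow, div_right_comm]
  refine squeeze_zero' ?_ ?_ h1
  · filter_upwards [(tendsto_logb_natCast hp0 hp1).eventually_ge_atTop 0] with N hN
    positivity
  · filter_upwards [(tendsto_logb_natCast hp0 hp1).eventually_ge_atTop 0,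
      eventually_ge_atTop 1] with N hN hN1
    have hN' : (1 : ℝ) ≤ N := by exact_mod_cast hN1
    exact div_le_div_of_nonneg_left (by positivity) (by linarith)
      (le_self_pow₀ hN' hb.ne')

/-- The failure probability tends to zero, so `δ` influences only `n₀` and one constant `C` serves
all `δ`. -/
lemma convergesWithHighProbability_of_hitsWindows {p : ℝ} (hp0 : 0 < p) (hp1 : p < 1)
    {err : (N : ℕ) → Finset (Fin N) → ℝ} {rate : ℕ → ℝ}
    (hrate : Tendsto rate atTop (𝓝 0)) {C : ℝ}
    (h : ∀ᶠ N in atTop, ∀ F : Finset (Fin N), HitsWindows (windowLength p N) F →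
      err N F ≤ C * rate N) :
    ConvergesWithHighProbability p err rate := by
  have hbad : Tendsto (fun N : ℕ => 1 - 1 / (N : ℝ) ^ 5) atTop (𝓝 1) := by
    have h5 : Tendsto (fun N : ℕ => 1 / (N : ℝ) ^ 5) atTop (𝓝 0) := by
      simpa using tendsto_logb_pow_div_pow hp0 hp1 0 (b := 5) (by norm_num)
    simpa using h5.const_sub 1
  have hgood : ∀ᶠ N : ℕ in atTop, 1 - 1 / (N : ℝ) ^ 5 ≤
      probability p {F : Finset (Fin N) | HitsWindows (windowLength p N) F} := by
    filter_upwards [eventually_ge_atTop 2] with N hN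
    have h1 := probability_not_hitsWindows_windowLength_le hp0 hp1 hN
    have h2 := probability_add_compl p {F : Finset (Fin N) | HitsWindows (windowLength p N) F}
    rw [Set.compl_ofPred] at h2
    linarith
  constructor
  · intro ε hε
    have hsmall : ∀ᶠ N in atTop, C * rate N ≤ ε := by
      have : Tendsto (fun N => C * rate N) atTop (𝓝 0) := by simpa using hrate.const_mul C
      exact this.eventually_le_const hε
    refine tendsto_of_tendsto_of_tendsto_of_le_of_le' hbad tendsto_const_nhds ?_
      (Eventually.of_forall fun N => probability_le_one hp0 hp1 _)
    filter_upwards [hgood, hsmall, h] with N h1 h2 h3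
    exact h1.trans (probability_mono hp0 hp1 fun F hF => (h3 F hF).trans h2)
  · refine ⟨C, fun δ hδ _ => ?_⟩
    have hδ' : ∀ᶠ N : ℕ in atTop, 1 - δ ≤ 1 - 1 / (N : ℝ) ^ 5 :=
      hbad.eventually_const_le (by linarith)
    obtain ⟨n₀, hn₀⟩ := eventually_atTop.1 ((hδ'.and hgood).and h)
    refine ⟨n₀, fun N hN => ?_⟩
    obtain ⟨⟨h1, h2⟩, h3⟩ := hn₀ N hN.le
    exact (h1.trans h2).trans (probability_mono hp0 hp1 fun F hF => h3 F hF)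

/-- The mean is split according to the window event; `hrate_ge` lets the rate absorb the exceptional
part `N² · N⁻⁵`. -/
lemma convergesInMean_of_hitsWindows {p : ℝ} (hp0 : 0 < p) (hp1 : p < 1)
    {err : (N : ℕ) → Finset (Fin N) → ℝ} {rate : ℕ → ℝ}
    (hrate : Tendsto rate atTop (𝓝 0))
    (hrate_ge : ∀ᶠ N : ℕ in atTop, 1 / (N : ℝ) ^ 3 ≤ rate N) (hnonneg : ∀ N F, 0 ≤ err N F)
    {C C' : ℝ} (hC' : 0 ≤ C')
    (h : ∀ᶠ N in atTop, ∀ F : Finset (Fin N), HitsWindows (windowLength p N) F →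
      err N F ≤ C * rate N)
    (h' : ∀ᶠ N : ℕ in atTop, ∀ F : Finset (Fin N), err N F ≤ C' * (N : ℝ) ^ 2) :
    ConvergesInMean p err rate := by
  have h0 : ∀ N, 0 ≤ expectation p (err N) := fun N => by
    rw [← expectation_const p 0 N]
    exact expectation_mono hp0 hp1 (hnonneg N)
  have hle : ∀ᶠ N in atTop, expectation p (err N) ≤ (|C| + C') * rate N := by
    filter_upwards [h, h', hrate_ge, eventually_ge_atTop 2] with N h1 h2 h3 hN
    have hN' : (2 : ℝ) ≤ N := by exact_mod_cast hN
    have hr : 0 ≤ rate N := le_trans (by positivity) h3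
    have hprob := probability_not_hitsWindows_windowLength_le hp0 hp1 hN
    calc expectation p (err N)
        ≤ expectation p (fun F => |C| * rate N + C' * (N : ℝ) ^ 2 *
            ({F : Finset (Fin N) | ¬ HitsWindows (windowLength p N) F}).indicator
              (fun _ => (1 : ℝ)) F) := by
          refine expectation_mono hp0 hp1 fun F => ?_
          by_cases hF : HitsWindows (windowLength p N) F
          · rw [Set.indicator_of_notMem (by simpa using hF), mul_zero, add_zero]
            exact (h1 F hF).trans (mul_le_mul_of_nonneg_right (le_abs_self C) hr)
          · rw [Set.indicator_of_mem (by exact hF), mul_one]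
            exact (h2 F).trans (le_add_of_nonneg_left (by positivity))
      _ = |C| * rate N + C' * (N : ℝ) ^ 2 *
            probability p {F : Finset (Fin N) | ¬ HitsWindows (windowLength p N) F} := by
          rw [expectation_add, expectation_const, expectation_const_mul, probability]
      _ ≤ |C| * rate N + C' * (N : ℝ) ^ 2 * (1 / (N : ℝ) ^ 5) := by gcongr
      _ = |C| * rate N + C' * (1 / (N : ℝ) ^ 3) := by field_simp
      _ ≤ |C| * rate N + C' * rate N := by gcongr
      _ = (|C| + C') * rate N := by ring
  constructor
  · refine squeeze_zero' (Eventually.of_forall h0) hle ?_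
    simpa using hrate.const_mul (|C| + C')
  · refine Asymptotics.IsBigO.of_bound (|C| + C') ?_
    filter_upwards [hle] with N hN
    rw [Real.norm_of_nonneg (h0 N), Real.norm_eq_abs]
    exact hN.trans (mul_le_mul_of_nonneg_left (le_abs_self _) (by positivity))

/-! ### Geometry of the decoder mapping points -/

section Nodes

variable {N : ℕ} {β : Fin N → ℝ}

lemma extendedNode_zero (β : Fin N → ℝ) : extendedNode β 0 = -1 := by simp [extendedNode]

lemma extendedNode_val_add_one (β : Fin N → ℝ) (v : Fin N) : extendedNode β (v + 1) = β v := by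
  simp [extendedNode]

lemma extendedNode_of_lt (β : Fin N → ℝ) {n : ℕ} (hn : N < n) : extendedNode β n = 1 := by
  have h1 : n ≠ 0 := by omega
  have h2 : ¬ n - 1 < N := by omega
  simp [extendedNode, h1, h2]

lemma extendedNode_lt_succ (hβ : StrictMono β) (hβΩ : ∀ n, β n ∈ Omega) {n : ℕ} (hn : n ≤ N) :
    extendedNode β n < extendedNode β (n + 1) := by
  rcases Nat.eq_zero_or_pos n with rfl | hpos
  · rw [extendedNode_zero]
    by_cases hN : 0 < N
    · exact (extendedNode_val_add_one β ⟨0, hN⟩).symm ▸ (hβΩ _).1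
    · rw [extendedNode_of_lt β (by omega)]; norm_num
  · obtain ⟨m, rfl⟩ : ∃ m, n = m + 1 := ⟨n - 1, by omega⟩
    rw [extendedNode_val_add_one β ⟨m, by omega⟩]
    by_cases hm : m + 1 < N
    · rw [extendedNode_val_add_one β ⟨m + 1, hm⟩]
      exact hβ (by simp)
    · rw [extendedNode_of_lt β (by omega)]
      exact (hβΩ _).2

lemma extendedNode_succ_sub_le_deltaMax (β : Fin N → ℝ) {n : ℕ} (hn : n ≤ N) :
    extendedNode β (n + 1) - extendedNode β n ≤ deltaMax β :=
  le_ciSup (f := fun n : Fin (N + 1) => extendedNode β (n + 1) - extendedNode β n)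
    (Set.finite_range _).bddAbove ⟨n, by omega⟩

lemma extendedNode_add_sub_le (β : Fin N → ℝ) {n k : ℕ} (hn : n + k ≤ N + 1) :
    extendedNode β (n + k) - extendedNode β n ≤ k * deltaMax β := by
  induction k with
  | zero => simp
  | succ k ih =>
    have h1 := ih (by omega)
    have h2 := extendedNode_succ_sub_le_deltaMax β (n := n + k) (by omega)
    rw [← add_assoc]; push_cast; linarith

lemma extendedNode_mono (hβ : StrictMono β) (hβΩ : ∀ n, β n ∈ Omega) {m n : ℕ} (hmn : m ≤ n) :
    extendedNode β m ≤ extendedNode β n := by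
  refine monotone_nat_of_le_succ (fun n => ?_) hmn
  rcases le_or_gt n N with h | h
  · exact (extendedNode_lt_succ hβ hβΩ h).le
  · rw [extendedNode_of_lt β h, extendedNode_of_lt β (by omega)]

/-- The `N + 1` gaps add up to the length `2` of `Ω`. -/
lemma two_le_mul_deltaMax (β : Fin N → ℝ) : 2 ≤ (N + 1) * deltaMax β := by
  have := extendedNode_add_sub_le β (n := 0) (k := N + 1) (by omega)
  rw [extendedNode_zero, zero_add, extendedNode_of_lt β (by omega)] at this
  push_cast at this; linarith

lemma deltaMin_le (β : Fin N → ℝ) {n : ℕ} (hn : n + 1 < N) :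
    deltaMin β ≤ extendedNode β (n + 2) - extendedNode β (n + 1) :=
  ciInf_le (f := fun n : Fin (N - 1) => extendedNode β (n + 2) - extendedNode β (n + 1))
    (Set.finite_range _).bddBelow ⟨n, by omega⟩

lemma deltaMin_pos (hβ : StrictMono β) (hβΩ : ∀ n, β n ∈ Omega) (hN : 2 ≤ N) :
    0 < deltaMin β := by
  have : Nonempty (Fin (N - 1)) := ⟨⟨0, by omega⟩⟩
  obtain ⟨i, hi⟩ := exists_eq_ciInf_of_finite
    (f := fun n : Fin (N - 1) => extendedNode β (n + 2) - extendedNode β (n + 1))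
  rw [deltaMin, ← hi]
  exact sub_pos.2 (extendedNode_lt_succ hβ hβΩ (by omega))

lemma deltaMin_le_sub (hβ : StrictMono β) (hβΩ : ∀ n, β n ∈ Omega) {i j : Fin N} (hij : i < j) :
    deltaMin β ≤ β j - β i := by
  have hij' : (i : ℕ) < j := hij
  have h1 := deltaMin_le β (n := i) (by omega)
  have h2 := extendedNode_mono hβ hβΩ (m := i + 2) (n := j + 1) (by omega)
  rw [extendedNode_val_add_one] at h1 h2
  linarith

lemma mul_deltaMin_le_two (hβ : StrictMono β) (hβΩ : ∀ n, β n ∈ Omega) :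
    ((N : ℝ) - 1) * deltaMin β ≤ 2 := by
  rcases Nat.eq_zero_or_pos N with rfl | hN
  -- For `N = 0` the infimum runs over an empty family and has the default value `0`.
  · simp [deltaMin]
  have key : ∀ k, k < N → k * deltaMin β ≤ extendedNode β (k + 1) - extendedNode β 1 := by
    intro k
    induction k with
    | zero => simp
    | succ k ih =>
      intro hk
      have h1 := ih (by omega)
      have h2 := deltaMin_le β hk
      push_cast; linarith
  have h1 := key (N - 1) (by omega)
  have h2 := extendedNode_mono hβ hβΩ (m := N - 1 + 1) (n := N + 1) (by omega)
  have h3 := extendedNode_mono hβ hβΩ (m := 0) (n := 1) (by omega)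
  rw [extendedNode_zero] at h3
  rw [extendedNode_of_lt β (n := N + 1) (by omega)] at h2
  push_cast [Nat.cast_sub hN] at h1
  linarith

lemma deltaMax_le_div (hβ : StrictMono β) (hβΩ : ∀ n, β n ∈ Omega) (hN : 2 ≤ N) {B : ℝ}
    (hB : 0 < B) (h : deltaMax β / deltaMin β ≤ B) : deltaMax β ≤ 4 * B / N := by
  have hN' : (2 : ℝ) ≤ N := by exact_mod_cast hN
  have h1 := (div_le_iff₀ (deltaMin_pos hβ hβΩ hN)).1 h
  have h2 := mul_deltaMin_le_two hβ hβΩ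
  have h3 := deltaMin_pos hβ hβΩ hN
  -- The bound `2` for `(N - 1) Δ_min` doubles because `N ≤ 2 (N - 1)`.
  have h4 : deltaMin β * N ≤ 4 := by nlinarith
  rw [le_div_iff₀ (by linarith)]
  nlinarith

lemma div_le_deltaMin (hβ : StrictMono β) (hβΩ : ∀ n, β n ∈ Omega) (hN : 2 ≤ N) {B : ℝ}
    (hB : 0 < B) (h : deltaMax β / deltaMin β ≤ B) : 1 / (B * N) ≤ deltaMin β := by
  have hN' : (2 : ℝ) ≤ N := by exact_mod_cast hN
  have h1 := (div_le_iff₀ (deltaMin_pos hβ hβΩ hN)).1 h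
  have h2 := two_le_mul_deltaMax β
  have h3 := deltaMin_pos hβ hβΩ hN
  have h4 : 0 ≤ deltaMax β := by by_contra! hc; nlinarith
  rw [div_le_iff₀ (by positivity)]
  nlinarith

/-- If every window of length `L` is hit, an interior point has responding neighbours on both
sides, at distance at most `L Δ_max`. -/
lemma HitsWindows.exists_neighbours (hβ : StrictMono β) (hβΩ : ∀ n, β n ∈ Omega) {L : ℕ}
    {F : Finset (Fin N)} (hF : HitsWindows L F) {z : ℝ} (hz : z ∈ Omega)
    (hz1 : (L + 1) * deltaMax β ≤ 1 + z) (hz2 : (L + 1) * deltaMax β ≤ 1 - z) :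
    ∃ v ∈ F, ∃ w ∈ F, β v ≤ z ∧ z < β w ∧ z - β v ≤ L * deltaMax β ∧
      β w - z ≤ L * deltaMax β := by
  have hpos : 0 < deltaMax β := by
    have := two_le_mul_deltaMax β
    by_contra! hc
    have h0 : (0 : ℝ) ≤ N := Nat.cast_nonneg N
    nlinarith
  -- The gap containing `z`; the distance of `z` from `±1` then leaves room for a full window on
  -- either side of it.
  obtain ⟨m, hmN, hm1, hm2⟩ : ∃ m ≤ N, extendedNode β m ≤ z ∧ z < extendedNode β (m + 1) := by
    classical
    let P : ℕ → Prop := fun n => extendedNode β n ≤ z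
    have h0 : P 0 := by simp only [P, extendedNode_zero]; exact hz.1.le
    refine ⟨Nat.findGreatest P N, Nat.findGreatest_le _,
      Nat.findGreatest_spec (P := P) (Nat.zero_le N) h0, ?_⟩
    rcases (Nat.findGreatest_le (P := P) N).lt_or_eq with h | h
    · exact not_le.1 (Nat.findGreatest_is_greatest (P := P) (Nat.lt_succ_self _) h)
    · rw [h, extendedNode_of_lt β (by omega)]; exact hz.2
  have hstep := extendedNode_succ_sub_le_deltaMax β hmN
  have hLm : L ≤ m := by
    have h1 := extendedNode_add_sub_le β (n := 0) (k := m) (by omega)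
    rw [extendedNode_zero, zero_add] at h1
    have h2 : (L : ℝ) * deltaMax β < (m + 1) * deltaMax β := by linarith
    have h3 : (L : ℝ) < m + 1 := lt_of_mul_lt_mul_right h2 hpos.le
    have h4 : L < m + 1 := by exact_mod_cast h3
    omega
  have hLm' : m + L ≤ N := by
    have h1 := extendedNode_add_sub_le β (n := m + 1) (k := N - m) (by omega)
    rw [show m + 1 + (N - m) = N + 1 by omega, extendedNode_of_lt β (by omega)] at h1
    have h2 : (L : ℝ) * deltaMax β < ((N - m : ℕ) + 1) * deltaMax β := by linarith
    have h3 : (L : ℝ) < (N - m : ℕ) + 1 := lt_of_mul_lt_mul_right h2 hpos.le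
    have h4 : L < N - m + 1 := by exact_mod_cast h3
    omega
  -- Server `n` occupies position `n + 1`. The window starting at `m - L` thus covers positions `m -
  -- L + 1, …, m`, all left of `z`, and the one starting at `m` covers `m + 1, …, m + L`, all right
  -- of it.
  obtain ⟨v, hvF, hv1, hv2⟩ := hF (m - L) (by omega)
  obtain ⟨w, hwF, hw1, hw2⟩ := hF m hLm'
  refine ⟨v, hvF, w, hwF, ?_, ?_, ?_, ?_⟩
  · have := extendedNode_mono hβ hβΩ (m := v + 1) (n := m) (by omega)
    rw [extendedNode_val_add_one] at this; linarith
  · have := extendedNode_mono hβ hβΩ (m := m + 1) (n := w + 1) (by omega)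
    rw [extendedNode_val_add_one] at this; linarith
  · have h1 := extendedNode_mono hβ hβΩ (m := m - L + 1) (n := v + 1) (by omega)
    have h2 := extendedNode_add_sub_le β (n := m - L + 1) (k := L) (by omega)
    rw [show m - L + 1 + L = m + 1 by omega] at h2
    rw [extendedNode_val_add_one] at h1; linarith
  · have h1 := extendedNode_mono hβ hβΩ (m := w + 1) (n := m + L) (by omega)
    have h2 := extendedNode_add_sub_le β (n := m) (k := L) (by omega)
    rw [extendedNode_val_add_one] at h1; linarith

end Nodes

/-- For a quasi-uniform family of nodes, with high probability every one of finitely many interior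
points has responding neighbours on both sides, at distance at most `28 B log_{1/p}(N) / N`. -/
lemma eventually_exists_neighbours {p : ℝ} (hp0 : 0 < p) (hp1 : p < 1) {K : ℕ} {α : Fin K → ℝ}
    (hαΩ : ∀ k, α k ∈ Omega) {β : (N : ℕ) → Fin N → ℝ} (hβ : ∀ N, StrictMono (β N))
    (hβΩ : ∀ N n, β N n ∈ Omega) {B : ℝ} (hB : 0 < B)
    (hβB : ∀ N, 2 ≤ N → deltaMax (β N) / deltaMin (β N) ≤ B) :
    ∀ᶠ N in atTop, ∀ F : Finset (Fin N), HitsWindows (windowLength p N) F → ∀ k,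
      ∃ v ∈ F, ∃ w ∈ F, β N v ≤ α k ∧ α k < β N w ∧
        α k - β N v ≤ 28 * B * (Real.logb (1 / p) N / N) ∧
        β N w - α k ≤ 28 * B * (Real.logb (1 / p) N / N) := by
  -- `28 = 7 · 4` comes from window length `≤ 7 log` and `Δ_max ≤ 4 B / N`; the additional gap in
  -- `(L + 1) Δ_max` raises it to `32`.
  have hlim : Tendsto (fun N : ℕ => 32 * B * (Real.logb (1 / p) N / N)) atTop (𝓝 0) := by
    have := tendsto_logb_pow_div_pow hp0 hp1 1 (b := 1) one_pos
    simpa using this.const_mul (32 * B)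
  have hsmall : ∀ᶠ N : ℕ in atTop, ∀ k, 32 * B * (Real.logb (1 / p) N / N) ≤ 1 + α k ∧
      32 * B * (Real.logb (1 / p) N / N) ≤ 1 - α k := by
    refine eventually_all.2 fun k => ?_
    have h1 : 0 < 1 + α k := by have := (hαΩ k).1; linarith
    have h2 : 0 < 1 - α k := by have := (hαΩ k).2; linarith
    exact (hlim.eventually_le_const h1).and (hlim.eventually_le_const h2)
  filter_upwards [hsmall, (tendsto_logb_natCast hp0 hp1).eventually_ge_atTop 1,
    eventually_ge_atTop 2] with N h1 h2 hN F hF k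
  have hN' : (2 : ℝ) ≤ N := by exact_mod_cast hN
  have hΔ := deltaMax_le_div (hβ N) (hβΩ N) hN hB (hβB N hN)
  have hL := windowLength_le h2
  have hL0 : (0 : ℝ) ≤ windowLength p N := Nat.cast_nonneg _
  have hdiv : 0 ≤ 4 * B / N := by positivity
  have hLΔ : windowLength p N * deltaMax (β N) ≤ 28 * B * (Real.logb (1 / p) N / N) :=
    calc windowLength p N * deltaMax (β N) ≤ windowLength p N * (4 * B / N) := by gcongr
      _ ≤ 7 * Real.logb (1 / p) N * (4 * B / N) := by gcongr
      _ = _ := by ring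
  have hL1Δ : (windowLength p N + 1) * deltaMax (β N) ≤ 32 * B * (Real.logb (1 / p) N / N) :=
    calc (windowLength p N + 1) * deltaMax (β N) ≤ (windowLength p N + 1) * (4 * B / N) := by gcongr
      _ ≤ (7 * Real.logb (1 / p) N + Real.logb (1 / p) N) * (4 * B / N) := by gcongr
      _ = _ := by ring
  obtain ⟨v, hv, w, hw, a1, a2, a3, a4⟩ := hF.exists_neighbours (hβ N) (hβΩ N) (hαΩ k)
    (hL1Δ.trans (h1 k).1) (hL1Δ.trans (h1 k).2)
  exact ⟨v, hv, w, hw, a1, a2, a3.trans hLΔ, a4.trans hLΔ⟩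

/-! ### Approximation errors -/

lemma approxError_nonneg {K : ℕ} (α x : Fin K → ℝ) (f dec : ℝ → ℝ) :
    0 ≤ approxError α x f dec :=
  mul_nonneg (by positivity) (Finset.sum_nonneg fun _ _ => sq_nonneg _)

lemma approxError_le {K : ℕ} (hK : 0 < K) {α x : Fin K → ℝ} {f dec : ℝ → ℝ} {c : ℝ}
    (h : ∀ k, (dec (α k) - f (x k)) ^ 2 ≤ c) : approxError α x f dec ≤ c := by
  have hK' : (0 : ℝ) < K := by exact_mod_cast hK
  have h1 : ∑ k : Fin K, (dec (α k) - f (x k)) ^ 2 ≤ K * c := by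
    simpa using Finset.sum_le_sum fun k (_ : k ∈ Finset.univ) => h k
  rw [approxError, one_div, inv_mul_le_iff₀ hK']
  exact h1

/-! ### Sobolev functions -/

lemma convex_Omega : Convex ℝ Omega := convex_Ioo _ _

lemma uIcc_subset_Omega {a b : ℝ} (ha : a ∈ Omega) (hb : b ∈ Omega) : Set.uIcc a b ⊆ Omega :=
  Set.OrdConnected.uIcc_subset Set.ordConnected_Ioo ha hb

lemma roughness_nonneg (u : ℝ → ℝ) : 0 ≤ roughness u :=
  integral_nonneg fun _ => sq_nonneg _

/-- Cauchy–Schwarz against the constant function, from expanding `0 ≤ ∫ ((b - a) φ - I)²`. -/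
lemma sq_intervalIntegral_le {φ : ℝ → ℝ} {a b : ℝ} (hab : a ≤ b)
    (h1 : IntervalIntegrable φ volume a b)
    (h2 : IntervalIntegrable (fun t => φ t ^ 2) volume a b) :
    (∫ t in a..b, φ t) ^ 2 ≤ (b - a) * ∫ t in a..b, φ t ^ 2 := by
  rcases hab.eq_or_lt with rfl | hab
  · simp
  set I := ∫ t in a..b, φ t
  have h3 : 0 ≤ ∫ t in a..b, ((b - a) * φ t - I) ^ 2 :=
    intervalIntegral.integral_nonneg hab.le fun _ _ => sq_nonneg _
  have h4 : ∫ t in a..b, ((b - a) * φ t - I) ^ 2 =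
      (b - a) ^ 2 * (∫ t in a..b, φ t ^ 2) - 2 * (b - a) * I * I + (b - a) * I ^ 2 := by
    have : ∀ t, ((b - a) * φ t - I) ^ 2 =
        (b - a) ^ 2 * φ t ^ 2 - 2 * (b - a) * I * φ t + I ^ 2 := fun t => by ring
    simp only [this]
    rw [intervalIntegral.integral_add ((h2.const_mul _).sub (h1.const_mul _)) (by simp),
      intervalIntegral.integral_sub (h2.const_mul _) (h1.const_mul _),
      intervalIntegral.integral_const_mul, intervalIntegral.integral_const_mul]
    simp [I]
  rw [h4] at h3
  have h5 : 0 ≤ (b - a) * ((b - a) * (∫ t in a..b, φ t ^ 2) - I ^ 2) := by linarith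
  have h6 := nonneg_of_mul_nonneg_right h5 (sub_pos.2 hab)
  linarith

/-- The embedding of `H²` into `C^{1,1/2}`: the fundamental theorem of calculus for the absolutely
continuous `u'`, then Cauchy–Schwarz. -/
lemma MemH2.sq_deriv_sub_le {u : ℝ → ℝ} (hu : MemH2 u) {s t : ℝ} (hs : s ∈ Omega)
    (ht : t ∈ Omega) : (deriv u t - deriv u s) ^ 2 ≤ |t - s| * roughness u := by
  wlog hst : s ≤ t generalizing s t
  · have := this ht hs (le_of_not_ge hst)
    rwa [abs_sub_comm, ← neg_sub (deriv u t), neg_sq] at this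
  have hac := hu.absolutelyContinuous s hs t ht
  have hsq : IntegrableOn (fun x => deriv (deriv u) x ^ 2) Omega := hu.memLp.integrable_sq
  have hsub : Set.Ioc s t ⊆ Omega := fun x hx => ⟨hs.1.trans hx.1, hx.2.trans_lt ht.2⟩
  have hsq' : IntervalIntegrable (fun x => deriv (deriv u) x ^ 2) volume s t :=
    (intervalIntegrable_iff_integrableOn_Ioc_of_le hst).2 (hsq.mono_set hsub)
  rw [← hac.integral_deriv_eq_sub, abs_of_nonneg (sub_nonneg.2 hst)]
  refine (sq_intervalIntegral_le hst hac.intervalIntegrable_deriv hsq').trans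
    (mul_le_mul_of_nonneg_left ?_ (sub_nonneg.2 hst))
  rw [intervalIntegral.integral_of_le hst]
  exact setIntegral_mono_set hsq (Eventually.of_forall fun _ => sq_nonneg _)
    (Eventually.of_forall hsub)

section BoundedSecondDerivative

variable {g : ℝ → ℝ} {M : ℝ}

lemma abs_deriv_sub_le_of_bounded (hg' : Differentiable ℝ (deriv g))
    (hM : ∀ t ∈ Omega, |deriv (deriv g) t| ≤ M) {s t : ℝ} (hs : s ∈ Omega) (ht : t ∈ Omega) :
    |deriv g t - deriv g s| ≤ M * |t - s| :=
  convex_Omega.norm_image_sub_le_of_norm_deriv_le (fun x _ => hg' x) hM hs ht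

lemma memH2_of_bounded (hg : Differentiable ℝ g) (hg' : Differentiable ℝ (deriv g))
    (hM : ∀ t ∈ Omega, |deriv (deriv g) t| ≤ M) : MemH2 g where
  differentiableOn := hg.differentiableOn
  absolutelyContinuous a ha b hb := by
    have hM0 : 0 ≤ M := (abs_nonneg _).trans (hM a ha)
    have : LipschitzOnWith M.toNNReal (deriv g) Omega :=
      LipschitzOnWith.of_dist_le_mul fun x hx y hy => by
        rw [Real.coe_toNNReal _ hM0, Real.dist_eq, Real.dist_eq]
        exact abs_deriv_sub_le_of_bounded hg' hM hy hx
    exact (this.mono (uIcc_subset_Omega ha hb)).absolutelyContinuousOnInterval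
  memLp := by
    have : IsFiniteMeasure (volume.restrict Omega) := by
      rw [Omega]; infer_instance
    refine MemLp.of_bound (measurable_deriv (deriv g)).aestronglyMeasurable M ?_
    exact (ae_restrict_iff' measurableSet_Ioo).2 (Eventually.of_forall hM)

lemma roughness_le_of_bounded (hM : ∀ t ∈ Omega, |deriv (deriv g) t| ≤ M) :
    roughness g ≤ 2 * M ^ 2 := by
  have h := norm_setIntegral_le_of_norm_le_const (μ := volume) (s := Omega)
    (f := fun t => deriv (deriv g) t ^ 2) (C := M ^ 2) (by simp [Omega]) fun t ht => by
      rw [norm_pow]; exact pow_le_pow_left₀ (norm_nonneg _) (hM t ht) 2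
  have hv : volume.real Omega = 2 := by
    rw [Omega, Real.volume_real_Ioo_of_le (by norm_num)]; norm_num
  rw [hv] at h
  have := (le_abs_self _).trans h
  rw [roughness]; linarith

end BoundedSecondDerivative

/-! ### Functions that are small at two points -/

lemma exists_deriv_mul_eq_sub {h : ℝ → ℝ} (hd : ∀ x ∈ Omega, DifferentiableAt ℝ h x) {a b : ℝ}
    (ha : a ∈ Omega) (hb : b ∈ Omega) :
    ∃ ξ ∈ Set.uIcc a b, h b - h a = deriv h ξ * (b - a) := by
  rcases lt_trichotomy a b with hab | rfl | hab
  · have hsub := uIcc_subset_Omega ha hb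
    rw [Set.uIcc_of_le hab.le] at hsub ⊢
    obtain ⟨ξ, hξ, h1⟩ := exists_deriv_eq_slope h hab
      (fun x hx => (hd x (hsub hx)).continuousAt.continuousWithinAt)
      (fun x hx => (hd x (hsub (Set.Ioo_subset_Icc_self hx))).differentiableWithinAt)
    refine ⟨ξ, Set.Ioo_subset_Icc_self hξ, ?_⟩
    have : b - a ≠ 0 := by linarith
    rw [h1]; field_simp
  · exact ⟨a, by simp, by simp⟩
  · have hsub := uIcc_subset_Omega ha hb
    rw [Set.uIcc_of_ge hab.le] at hsub ⊢
    obtain ⟨ξ, hξ, h1⟩ := exists_deriv_eq_slope h hab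
      (fun x hx => (hd x (hsub hx)).continuousAt.continuousWithinAt)
      (fun x hx => (hd x (hsub (Set.Ioo_subset_Icc_self hx))).differentiableWithinAt)
    refine ⟨ξ, Set.Ioo_subset_Icc_self hξ, ?_⟩
    have : a - b ≠ 0 := by linarith
    rw [h1]; field_simp; ring

/-- Between two points `a < b` where `h² ≤ E`, a function whose derivative oscillates by at most
`ω` satisfies `h² ≤ 2 E + 2 (b - a)² ω²`. -/
lemma sq_le_of_between {h : ℝ → ℝ} (hd : ∀ x ∈ Omega, DifferentiableAt ℝ h x) {a b z E W : ℝ}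
    (ha : a ∈ Omega) (hb : b ∈ Omega) (haz : a ≤ z) (hzb : z < b)
    (hEa : h a ^ 2 ≤ E) (hEb : h b ^ 2 ≤ E)
    (hW : ∀ s ∈ Set.Icc a b, ∀ t ∈ Set.Icc a b, (deriv h t - deriv h s) ^ 2 ≤ W) :
    h z ^ 2 ≤ 2 * E + 2 * (b - a) ^ 2 * W := by
  have hab : a < b := haz.trans_lt hzb
  have hz : z ∈ Omega := ⟨ha.1.trans_le haz, hzb.trans hb.2⟩
  obtain ⟨ξ, hξ, h1⟩ := exists_deriv_mul_eq_sub hd ha hb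
  obtain ⟨ζ, hζ, h2⟩ := exists_deriv_mul_eq_sub hd ha hz
  rw [Set.uIcc_of_le hab.le] at hξ
  rw [Set.uIcc_of_le haz] at hζ
  have h3 := hW ξ hξ ζ ⟨hζ.1, hζ.2.trans hzb.le⟩
  set D := deriv h ζ - deriv h ξ
  set θ := (z - a) / (b - a)
  have hba : 0 < b - a := sub_pos.2 hab
  have hθ0 : 0 ≤ θ := div_nonneg (sub_nonneg.2 haz) hba.le
  have hθ1 : θ ≤ 1 := (div_le_one hba).2 (by linarith)
  have hza : z - a = θ * (b - a) := (div_mul_cancel₀ _ hba.ne').symm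
  -- Linear interpolation between `a` and `b`, whose square is at most `E` by convexity, plus a
  -- remainder governed by the difference `D` of two values of `h'`.
  have h4 : h z = ((1 - θ) * h a + θ * h b) + D * (z - a) := by
    have : D * (z - a) = deriv h ζ * (z - a) - θ * (deriv h ξ * (b - a)) := by
      simp only [D]; rw [hza]; ring
    rw [this, ← h1, ← h2]; ring
  have h5 : ((1 - θ) * h a + θ * h b) ^ 2 ≤ E := by
    have : ((1 - θ) * h a + θ * h b) ^ 2 =
        (1 - θ) * h a ^ 2 + θ * h b ^ 2 - θ * (1 - θ) * (h a - h b) ^ 2 := by ring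
    have h6 : 0 ≤ θ * (1 - θ) * (h a - h b) ^ 2 :=
      mul_nonneg (mul_nonneg hθ0 (by linarith)) (sq_nonneg _)
    nlinarith
  have h6 : (D * (z - a)) ^ 2 ≤ (b - a) ^ 2 * W := by
    rw [mul_pow, mul_comm]
    exact mul_le_mul (pow_le_pow_left₀ (sub_nonneg.2 haz) (by linarith) 2) h3 (sq_nonneg _)
      (sq_nonneg _)
  rw [h4]
  nlinarith [sq_nonneg (((1 - θ) * h a + θ * h b) - D * (z - a))]

/-- The analogue of `sq_le_of_between` for arbitrary positions in `Ω`. -/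
lemma sq_le_of_mem_Omega {h : ℝ → ℝ} (hd : ∀ x ∈ Omega, DifferentiableAt ℝ h x) {a b z E W δ : ℝ}
    (ha : a ∈ Omega) (hb : b ∈ Omega) (hz : z ∈ Omega) (hδ : 0 < δ) (hab : δ ≤ b - a)
    (hEa : h a ^ 2 ≤ E) (hEb : h b ^ 2 ≤ E)
    (hW : ∀ s ∈ Omega, ∀ t ∈ Omega, (deriv h t - deriv h s) ^ 2 ≤ W) :
    h z ^ 2 ≤ 2 * E + 8 * (8 * E / δ ^ 2 + 2 * W) := by
  obtain ⟨ξ, hξ, h1⟩ := exists_deriv_mul_eq_sub hd ha hb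
  obtain ⟨ζ, hζ, h2⟩ := exists_deriv_mul_eq_sub hd ha hz
  have h3 := hW ξ (uIcc_subset_Omega ha hb hξ) ζ (uIcc_subset_Omega ha hz hζ)
  -- At `ξ` the derivative is the slope of the chord over `[a, b]`; the oscillation bound carries
  -- this to `ζ`, hence to `z`.
  have h4 : deriv h ξ ^ 2 ≤ 4 * E / δ ^ 2 := by
    rw [le_div_iff₀ (by positivity)]
    calc deriv h ξ ^ 2 * δ ^ 2 ≤ deriv h ξ ^ 2 * (b - a) ^ 2 := by gcongr
      _ = (h b - h a) ^ 2 := by rw [h1]; ring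
      _ ≤ 4 * E := by nlinarith [sq_nonneg (h b + h a)]
  have h5 : deriv h ζ ^ 2 ≤ 8 * E / δ ^ 2 + 2 * W := by
    have h6 : 8 * E / δ ^ 2 = 2 * (4 * E / δ ^ 2) := by ring
    rw [h6]
    nlinarith [sq_nonneg (2 * deriv h ξ - deriv h ζ)]
  have h6 : (z - a) ^ 2 ≤ 4 := by
    have := hz.1; have := hz.2; have := ha.1; have := ha.2
    nlinarith
  have h7 : (deriv h ζ * (z - a)) ^ 2 ≤ 4 * (8 * E / δ ^ 2 + 2 * W) := by
    rw [mul_pow, mul_comm]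
    exact mul_le_mul h6 h5 (sq_nonneg _) (by norm_num)
  have h8 : h z = h a + deriv h ζ * (z - a) := by linarith
  rw [h8]
  nlinarith [sq_nonneg (h a - deriv h ζ * (z - a))]

/-! ### The LeTCC decoder -/

section Decoder

variable {f enc : ℝ → ℝ} {N : ℕ} {β : Fin N → ℝ} {lam : ℝ} {F : Finset (Fin N)} {u : ℝ → ℝ}

lemma letccObjective_comp (lam : ℝ) (F : Finset (Fin N)) :
    letccObjective f enc β lam F (f ∘ enc) = lam * roughness (f ∘ enc) := by
  simp [letccObjective]

/-- The competitor `f ∘ enc` has zero residuals. For `lam > 0` only the penalties remain to be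
compared; for `lam = 0` it is itself a minimiser, so the least-roughness clause applies. -/
lemma IsLetccDecoder.roughness_le (hu : IsLetccDecoder f enc β lam F u) (hlam : 0 ≤ lam)
    (hg : MemH2 (f ∘ enc)) : roughness u ≤ roughness (f ∘ enc) := by
  rcases hlam.eq_or_lt with rfl | hpos
  · refine hu.2 rfl _ ⟨hg, fun w _ => ?_⟩
    rw [letccObjective_comp, letccObjective, zero_mul, zero_mul, add_zero]
    exact mul_nonneg (by positivity) (Finset.sum_nonneg fun _ _ => sq_nonneg _)
  · have h := hu.1.2 _ hg
    rw [letccObjective_comp, letccObjective] at h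
    have h1 : 0 ≤ 1 / (F.card : ℝ) * ∑ v ∈ F, (u (β v) - f (enc (β v))) ^ 2 :=
      mul_nonneg (by positivity) (Finset.sum_nonneg fun _ _ => sq_nonneg _)
    exact le_of_mul_le_mul_left (by linarith) hpos

/-- One squared residual is at most the whole sum, which is at most `|F| · lam · roughness (f ∘
enc)`, and `|F| · lam ≤ N · N⁻⁴`. -/
lemma IsLetccDecoder.sq_residual_le (hu : IsLetccDecoder f enc β lam F u) (hlam : 0 ≤ lam)
    (hlam' : lam ≤ 1 / (N : ℝ) ^ 4) (hg : MemH2 (f ∘ enc)) {v : Fin N} (hv : v ∈ F) :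
    (u (β v) - f (enc (β v))) ^ 2 ≤ roughness (f ∘ enc) / (N : ℝ) ^ 3 := by
  have h := hu.1.2 _ hg
  rw [letccObjective_comp, letccObjective] at h
  have h1 : 0 ≤ lam * roughness u := mul_nonneg hlam (roughness_nonneg u)
  have hF : (0 : ℝ) < F.card := by exact_mod_cast Finset.card_pos.2 ⟨v, hv⟩
  have hFN : (F.card : ℝ) ≤ N := by exact_mod_cast (Finset.card_le_univ F).trans (by simp)
  have hN : (0 : ℝ) < N := hF.trans_le hFN
  have hR := roughness_nonneg (f ∘ enc)
  have h2 : 1 / (F.card : ℝ) * ∑ v ∈ F, (u (β v) - f (enc (β v))) ^ 2 ≤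
      lam * roughness (f ∘ enc) := by linarith
  rw [one_div, inv_mul_le_iff₀ hF] at h2
  calc (u (β v) - f (enc (β v))) ^ 2 ≤ ∑ v ∈ F, (u (β v) - f (enc (β v))) ^ 2 :=
        Finset.single_le_sum (f := fun v => (u (β v) - f (enc (β v))) ^ 2)
          (fun _ _ => sq_nonneg _) hv
    _ ≤ F.card * (lam * roughness (f ∘ enc)) := h2
    _ ≤ N * (1 / (N : ℝ) ^ 4 * roughness (f ∘ enc)) := by gcongr
    _ = roughness (f ∘ enc) / (N : ℝ) ^ 3 := by field_simp

lemma IsLetccDecoder.differentiableAt_error (hu : IsLetccDecoder f enc β lam F u)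
    (hg : Differentiable ℝ (f ∘ enc)) {t : ℝ} (ht : t ∈ Omega) :
    DifferentiableAt ℝ (u - f ∘ enc) t :=
  (hu.1.1.differentiableOn.differentiableAt (isOpen_Ioo.mem_nhds ht)).sub (hg t)

/-- The squared increments of `u'` and of `(f ∘ enc)'` are each at most `2 M² |t - s|`, the latter
because `|t - s|² ≤ 2 |t - s|` on `Ω`; then `(x - y)² ≤ 2 x² + 2 y²`. -/
lemma IsLetccDecoder.sq_deriv_error_sub_le (hu : IsLetccDecoder f enc β lam F u)
    (hlam : 0 ≤ lam) (hg : Differentiable ℝ (f ∘ enc)) (hg' : Differentiable ℝ (deriv (f ∘ enc)))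
    {M : ℝ} (hM : ∀ t ∈ Omega, |deriv (deriv (f ∘ enc)) t| ≤ M) {s t : ℝ} (hs : s ∈ Omega)
    (ht : t ∈ Omega) :
    (deriv (u - f ∘ enc) t - deriv (u - f ∘ enc) s) ^ 2 ≤ 8 * M ^ 2 * |t - s| := by
  have hd : ∀ x ∈ Omega, deriv (u - f ∘ enc) x = deriv u x - deriv (f ∘ enc) x := fun x hx =>
    deriv_sub (hu.1.1.differentiableOn.differentiableAt (isOpen_Ioo.mem_nhds hx)) (hg x)
  have h1 := hu.1.1.sq_deriv_sub_le hs ht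
  have h2 := abs_deriv_sub_le_of_bounded hg' hM hs ht
  have h3 : roughness u ≤ 2 * M ^ 2 :=
    (hu.roughness_le hlam (memH2_of_bounded hg hg' hM)).trans (roughness_le_of_bounded hM)
  have h4 : |t - s| ≤ 2 := by
    rw [abs_le]
    constructor <;> linarith [hs.1, hs.2, ht.1, ht.2]
  have h5 : (deriv (f ∘ enc) t - deriv (f ∘ enc) s) ^ 2 ≤ 2 * M ^ 2 * |t - s| := by
    rw [← sq_abs]
    calc |deriv (f ∘ enc) t - deriv (f ∘ enc) s| ^ 2 ≤ (M * |t - s|) ^ 2 := by gcongr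
      _ = M ^ 2 * |t - s| * |t - s| := by ring
      _ ≤ M ^ 2 * |t - s| * 2 := by gcongr
      _ = _ := by ring
  have h6 : (deriv u t - deriv u s) ^ 2 ≤ 2 * M ^ 2 * |t - s| := by
    refine h1.trans ?_
    rw [mul_comm]
    exact mul_le_mul_of_nonneg_right h3 (abs_nonneg _)
  rw [hd t ht, hd s hs]
  nlinarith [sq_nonneg ((deriv u t - deriv u s) + (deriv (f ∘ enc) t - deriv (f ∘ enc) s))]

end Decoder

lemma comp_bounded_second_deriv {f enc : ℝ → ℝ} {ν : NNReal} {η : ℝ} (hf : LipschitzWith ν f)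
    (hfd : Differentiable ℝ f) (hfd' : Differentiable ℝ (deriv f))
    (hη : ∀ y, |deriv (deriv f) y| ≤ η) (he : ContDiff ℝ 2 enc) :
    Differentiable ℝ (f ∘ enc) ∧ Differentiable ℝ (deriv (f ∘ enc)) ∧
      ∃ M, ∀ t ∈ Omega, |deriv (deriv (f ∘ enc)) t| ≤ M := by
  have hed : Differentiable ℝ enc := he.differentiable (by norm_num)
  have he' : ContDiff ℝ 1 (deriv enc) := ((contDiff_succ_iff_deriv (n := 1)).1 he).2.2
  have hed' : Differentiable ℝ (deriv enc) := he'.differentiable (by norm_num)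
  have h1 : deriv (f ∘ enc) = fun t => deriv f (enc t) * deriv enc t := by
    funext t; exact deriv_comp t (hfd _) (hed t)
  -- Since `f''` need not be continuous, the composition need not be `C²`; its second derivative is
  -- computed and bounded pointwise.
  have h2 : ∀ t, HasDerivAt (deriv (f ∘ enc))
      (deriv (deriv f) (enc t) * deriv enc t * deriv enc t +
        deriv f (enc t) * deriv (deriv enc) t) t := fun t => by
    rw [h1]
    exact (((hfd' _).hasDerivAt.comp t (hed t).hasDerivAt).mul (hed' t).hasDerivAt)
  obtain ⟨A, hA⟩ := isCompact_Icc.exists_bound_of_continuousOn (s := Set.Icc (-1 : ℝ) 1)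
    he'.continuous.continuousOn
  obtain ⟨A', hA'⟩ := isCompact_Icc.exists_bound_of_continuousOn (s := Set.Icc (-1 : ℝ) 1)
    (he'.continuous_deriv le_rfl).continuousOn
  refine ⟨hfd.comp hed, fun t => (h2 t).differentiableAt, η * A * A + ν * A', fun t ht => ?_⟩
  have ht' : t ∈ Set.Icc (-1 : ℝ) 1 := Set.Ioo_subset_Icc_self ht
  have hη0 : 0 ≤ η := (abs_nonneg _).trans (hη 0)
  have hA0 : 0 ≤ A := (norm_nonneg _).trans (hA t ht')
  have hν : |deriv f (enc t)| ≤ ν := norm_deriv_le_of_lipschitz hf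
  rw [(h2 t).deriv]
  refine (abs_add_le _ _).trans (add_le_add ?_ ?_)
  · rw [abs_mul, abs_mul]
    have := hA t ht'
    rw [Real.norm_eq_abs] at this
    gcongr
    exact hη _
  · rw [abs_mul]
    exact mul_le_mul hν (hA' t ht') (abs_nonneg _) ν.2

/-! ### Convergence rates of LeTCC -/

section Letcc

variable {p : ℝ} {K : ℕ} {x α : Fin K → ℝ} {β : (N : ℕ) → Fin N → ℝ} {B : ℝ} {f enc : ℝ → ℝ}
  {M : ℝ} {lam : ℕ → ℝ} {dec : (N : ℕ) → Finset (Fin N) → ℝ → ℝ}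

/-- The LeTCC error when all windows are hit. -/
lemma letcc_error_le_of_hitsWindows (hp0 : 0 < p) (hp1 : p < 1) (hK : 0 < K)
    (hαΩ : ∀ k, α k ∈ Omega) (hβ : ∀ N, StrictMono (β N)) (hβΩ : ∀ N n, β N n ∈ Omega)
    (hB : 0 < B) (hβB : ∀ N, 2 ≤ N → deltaMax (β N) / deltaMin (β N) ≤ B)
    (hg : Differentiable ℝ (f ∘ enc)) (hg' : Differentiable ℝ (deriv (f ∘ enc)))
    (hM : ∀ t ∈ Omega, |deriv (deriv (f ∘ enc)) t| ≤ M) (henc : ∀ k, enc (α k) = x k)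
    (hlam : ∀ N, 1 ≤ N → 0 ≤ lam N ∧ lam N ≤ 1 / (N : ℝ) ^ 4)
    (hdec : ∀ N F, F.Nonempty → IsLetccDecoder f enc (β N) (lam N) F (dec N F)) :
    ∀ᶠ N in atTop, ∀ F : Finset (Fin N), HitsWindows (windowLength p N) F →
      approxError α x f (dec N F) ≤
        (4 * M ^ 2 + 16 * M ^ 2 * (56 * B) ^ 3) * (Real.logb (1 / p) N ^ 3 / (N : ℝ) ^ 3) := by
  filter_upwards [eventually_exists_neighbours hp0 hp1 hαΩ hβ hβΩ hB hβB,
    (tendsto_logb_natCast hp0 hp1).eventually_ge_atTop 1, eventually_ge_atTop 1]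
    with N hnb hlog hN F hF
  have hN' : (1 : ℝ) ≤ N := by exact_mod_cast hN
  refine approxError_le hK fun k => ?_
  obtain ⟨v, hv, w, hw, hvk, hkw, hdv, hdw⟩ := hnb F hF k
  have hu := hdec N F ⟨v, hv⟩
  obtain ⟨hl0, hl1⟩ := hlam N hN
  have hgH := memH2_of_bounded hg hg' hM
  have hR := roughness_le_of_bounded hM
  set q := Real.logb (1 / p) N / N
  have hq : 0 ≤ q := by positivity
  have hres : ∀ v ∈ F, ((dec N F - f ∘ enc) (β N v)) ^ 2 ≤ 2 * M ^ 2 * (1 / (N : ℝ) ^ 3) := by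
    intro v hv
    refine (hu.sq_residual_le hl0 hl1 hgH hv).trans ?_
    rw [div_eq_mul_one_div]
    gcongr
  have hd : β N w - β N v ≤ 56 * B * q := by linarith
  have hvw : 0 ≤ β N w - β N v := by linarith
  have key := sq_le_of_between (fun t ht => hu.differentiableAt_error hg ht) (hβΩ N v) (hβΩ N w)
    hvk hkw (hres v hv) (hres w hw) (W := 8 * M ^ 2 * (β N w - β N v)) fun s hs t ht => by
      have hsub : Set.Icc (β N v) (β N w) ⊆ Omega := fun y hy =>
        ⟨(hβΩ N v).1.trans_le hy.1, hy.2.trans_lt (hβΩ N w).2⟩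
      refine (hu.sq_deriv_error_sub_le hl0 hg hg' hM (hsub hs) (hsub ht)).trans ?_
      have : |t - s| ≤ β N w - β N v := by
        rw [abs_le]
        constructor <;> linarith [hs.1, hs.2, ht.1, ht.2]
      gcongr
  have hval : (dec N F - f ∘ enc) (α k) = dec N F (α k) - f (x k) := by
    simp [henc k]
  rw [hval] at key
  -- The residual term is absorbed into the rate because the logarithm is at least `1`.
  have hq3 : 1 / (N : ℝ) ^ 3 ≤ q ^ 3 := by
    rw [div_pow]
    gcongr
    exact one_le_pow₀ hlog
  rw [← div_pow]
  calc (dec N F (α k) - f (x k)) ^ 2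
      ≤ 2 * (2 * M ^ 2 * (1 / (N : ℝ) ^ 3)) +
          2 * (β N w - β N v) ^ 2 * (8 * M ^ 2 * (β N w - β N v)) := key
    _ = 4 * M ^ 2 * (1 / (N : ℝ) ^ 3) + 16 * M ^ 2 * (β N w - β N v) ^ 3 := by ring
    _ ≤ 4 * M ^ 2 * q ^ 3 + 16 * M ^ 2 * (56 * B * q) ^ 3 := by gcongr
    _ = _ := by ring

/-- The LeTCC error is bounded when at least two servers respond. -/
lemma letcc_error_le_of_two_le_card (hK : 0 < K)
    (hαΩ : ∀ k, α k ∈ Omega) (hβ : ∀ N, StrictMono (β N)) (hβΩ : ∀ N n, β N n ∈ Omega)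
    (hB : 0 < B) (hβB : ∀ N, 2 ≤ N → deltaMax (β N) / deltaMin (β N) ≤ B)
    (hg : Differentiable ℝ (f ∘ enc)) (hg' : Differentiable ℝ (deriv (f ∘ enc)))
    (hM : ∀ t ∈ Omega, |deriv (deriv (f ∘ enc)) t| ≤ M) (henc : ∀ k, enc (α k) = x k)
    (hlam : ∀ N, 1 ≤ N → 0 ≤ lam N ∧ lam N ≤ 1 / (N : ℝ) ^ 4)
    (hdec : ∀ N F, F.Nonempty → IsLetccDecoder f enc (β N) (lam N) F (dec N F))
    {N : ℕ} {F : Finset (Fin N)} (hF : 2 ≤ F.card) :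
    approxError α x f (dec N F) ≤ 4 * M ^ 2 + 8 * (16 * M ^ 2 * B ^ 2 + 32 * M ^ 2) := by
  have hN : 2 ≤ N := hF.trans ((Finset.card_le_univ F).trans (by simp))
  have hN' : (2 : ℝ) ≤ N := by exact_mod_cast hN
  refine approxError_le hK fun k => ?_
  obtain ⟨v, hv, w, hw, hvw⟩ : ∃ v ∈ F, ∃ w ∈ F, v < w := by
    obtain ⟨a, ha, b, hb, hab⟩ := Finset.one_lt_card.1 hF
    rcases lt_or_gt_of_ne hab with h | h
    · exact ⟨a, ha, b, hb, h⟩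
    · exact ⟨b, hb, a, ha, h⟩
  have hu := hdec N F ⟨v, hv⟩
  obtain ⟨hl0, hl1⟩ := hlam N (by omega)
  have hgH := memH2_of_bounded hg hg' hM
  have hR := roughness_le_of_bounded hM
  have hδ := (div_le_deltaMin (hβ N) (hβΩ N) hN hB (hβB N hN)).trans
    (deltaMin_le_sub (hβ N) (hβΩ N) hvw)
  have hres : ∀ v ∈ F, ((dec N F - f ∘ enc) (β N v)) ^ 2 ≤ 2 * M ^ 2 / (N : ℝ) ^ 3 := by
    intro v hv
    refine (hu.sq_residual_le hl0 hl1 hgH hv).trans ?_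
    gcongr
  have key := sq_le_of_mem_Omega (fun t ht => hu.differentiableAt_error hg ht) (hβΩ N v) (hβΩ N w)
    (hαΩ k) (by positivity) hδ (hres v hv) (hres w hw) (W := 16 * M ^ 2) fun s hs t ht => by
      refine (hu.sq_deriv_error_sub_le hl0 hg hg' hM hs ht).trans ?_
      have : |t - s| ≤ 2 := by
        rw [abs_le]
        constructor <;> linarith [hs.1, hs.2, ht.1, ht.2]
      calc 8 * M ^ 2 * |t - s| ≤ 8 * M ^ 2 * 2 := by gcongr
        _ = 16 * M ^ 2 := by ring
  have hval : (dec N F - f ∘ enc) (α k) = dec N F (α k) - f (x k) := by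
    simp [henc k]
  rw [hval] at key
  have h1 : 2 * M ^ 2 / (N : ℝ) ^ 3 ≤ 2 * M ^ 2 :=
    div_le_self (by positivity) (one_le_pow₀ (by linarith))
  -- Even for adjacent nodes the chord slope stays bounded: squared residuals of order `N⁻³` are
  -- divided by a squared gap of order at least `N⁻²`.
  have h2 : 8 * (2 * M ^ 2 / (N : ℝ) ^ 3) / (1 / (B * N)) ^ 2 ≤ 16 * M ^ 2 * B ^ 2 := by
    have : 8 * (2 * M ^ 2 / (N : ℝ) ^ 3) / (1 / (B * N)) ^ 2 = 16 * M ^ 2 * B ^ 2 / N := by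
      field_simp; ring
    rw [this]
    exact div_le_self (by positivity) (by linarith)
  linarith

theorem letcc_convergence (hp0 : 0 < p) (hp1 : p < 1) (hK : 0 < K)
    (hαΩ : ∀ k, α k ∈ Omega) (hβ : ∀ N, StrictMono (β N)) (hβΩ : ∀ N n, β N n ∈ Omega)
    (hB : 0 < B) (hβB : ∀ N, 2 ≤ N → deltaMax (β N) / deltaMin (β N) ≤ B)
    (hg : Differentiable ℝ (f ∘ enc)) (hg' : Differentiable ℝ (deriv (f ∘ enc)))
    (hM : ∀ t ∈ Omega, |deriv (deriv (f ∘ enc)) t| ≤ M) (henc : ∀ k, enc (α k) = x k)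
    (hlam : ∀ N, 1 ≤ N → 0 ≤ lam N ∧ lam N ≤ 1 / (N : ℝ) ^ 4)
    (hdec : ∀ N F, F.Nonempty → IsLetccDecoder f enc (β N) (lam N) F (dec N F)) :
    ConvergesWithHighProbability p (fun N F => approxError α x f (dec N F))
        (fun N => Real.logb (1 / p) N ^ 3 / (N : ℝ) ^ 3) ∧
      ((∃ D : ℝ, ∀ N F, F.card < 2 → ∀ k, |dec N F (α k)| ≤ D) →
        ConvergesInMean p (fun N F => approxError α x f (dec N F))
          (fun N => Real.logb (1 / p) N ^ 3 / (N : ℝ) ^ 3)) := by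
  have hgood := letcc_error_le_of_hitsWindows hp0 hp1 hK hαΩ hβ hβΩ hB hβB hg hg' hM henc hlam hdec
  have hrate := tendsto_logb_pow_div_pow hp0 hp1 3 (b := 3) (by norm_num)
  refine ⟨convergesWithHighProbability_of_hitsWindows hp0 hp1 hrate hgood, ?_⟩
  rintro ⟨D, hD⟩
  set C₁ := 4 * M ^ 2 + 8 * (16 * M ^ 2 * B ^ 2 + 32 * M ^ 2)
  set C₂ := 2 * D ^ 2 + 2 * ∑ k, f (x k) ^ 2
  have hC₁ : 0 ≤ C₁ := by positivity
  have hC₂ : 0 ≤ C₂ := by positivity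
  refine convergesInMean_of_hitsWindows hp0 hp1 hrate ?_ (fun N F => approxError_nonneg _ _ _ _)
    (add_nonneg hC₁ hC₂) hgood ?_
  · filter_upwards [(tendsto_logb_natCast hp0 hp1).eventually_ge_atTop 1] with N hlog
    gcongr
    exact one_le_pow₀ hlog
  · filter_upwards [eventually_ge_atTop 1] with N hN F
    have hN' : (1 : ℝ) ≤ N := by exact_mod_cast hN
    have hbound : approxError α x f (dec N F) ≤ C₁ + C₂ := by
      rcases lt_or_ge F.card 2 with hF | hF
      · refine (approxError_le hK fun k => ?_).trans (le_add_of_nonneg_left hC₁)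
        have h1 : dec N F (α k) ^ 2 ≤ D ^ 2 := by
          rw [← sq_abs]
          exact pow_le_pow_left₀ (abs_nonneg _) (hD N F hF k) 2
        have h2 : f (x k) ^ 2 ≤ ∑ k, f (x k) ^ 2 :=
          Finset.single_le_sum (f := fun k => f (x k) ^ 2) (fun _ _ => sq_nonneg _)
            (Finset.mem_univ k)
        nlinarith [sq_nonneg (dec N F (α k) + f (x k))]
      · exact (letcc_error_le_of_two_le_card hK hαΩ hβ hβΩ hB hβB hg hg' hM henc hlam hdec
          hF).trans (le_add_of_nonneg_right hC₂)
    -- Here the error is bounded outright; the factor `N ^ 2` is the allowance that BACC needs.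
    exact hbound.trans (le_mul_of_one_le_right (add_nonneg hC₁ hC₂) (one_le_pow₀ hN'))

end Letcc

/-! ### Alternating sums -/

section Alternating

/-- The alternating sum of `φ` over the elements of `F` in increasing order. -/
noncomputable def alternatingSum {n : ℕ} (F : Finset (Fin n)) (φ : Fin n → ℝ) : ℝ :=
  ∑ v ∈ F, alternatingSign F v * φ v

variable {n : ℕ} {F : Finset (Fin n)} {m : Fin n}

lemma abs_alternatingSign (F : Finset (Fin n)) (v : Fin n) : |alternatingSign F v| = 1 := by
  simp [alternatingSign]

/-- A new smallest element takes the sign `+` and flips all others. This recursion drives the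
inductions on alternating sums. -/
lemma alternatingSum_insert_min (hm : ∀ v ∈ F, m < v) (φ : Fin n → ℝ) :
    alternatingSum (insert m F) φ = φ m - alternatingSum F φ := by
  have hmF : m ∉ F := fun h => lt_irrefl _ (hm m h)
  have h1 : (insert m F).filter (· < m) = ∅ := by
    ext v
    simp only [Finset.mem_filter, Finset.mem_insert, Finset.notMem_empty, iff_false, not_and,
      not_lt]
    rintro (rfl | hv)
    · exact le_rfl
    · exact (hm v hv).le
  have h2 : ∀ v ∈ F, alternatingSign (insert m F) v = - alternatingSign F v := fun v hv => by
    rw [alternatingSign, Finset.filter_insert, if_pos (hm v hv),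
      Finset.card_insert_of_notMem (by simp [hmF]), pow_succ, alternatingSign]
    ring
  rw [alternatingSum, Finset.sum_insert hmF, alternatingSign, h1, alternatingSum,
    sub_eq_add_neg, ← Finset.sum_neg_distrib]
  congr 1
  · simp
  · exact Finset.sum_congr rfl fun v hv => by rw [h2 v hv]; ring

lemma alternatingSum_insert_max (hm : ∀ v ∈ F, v < m) (φ : Fin n → ℝ) :
    alternatingSum (insert m F) φ = alternatingSum F φ + (-1) ^ F.card * φ m := by
  have hmF : m ∉ F := fun h => lt_irrefl _ (hm m h)
  have h1 : (insert m F).filter (· < m) = F := by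
    ext v
    simp only [Finset.mem_filter, Finset.mem_insert]
    constructor
    · rintro ⟨rfl | hv, h⟩
      · exact absurd h (lt_irrefl _)
      · exact hv
    · exact fun hv => ⟨Or.inr hv, hm v hv⟩
  have h2 : ∀ v ∈ F, alternatingSign (insert m F) v = alternatingSign F v := fun v hv => by
    rw [alternatingSign, Finset.filter_insert, if_neg (hm v hv).not_gt, alternatingSign]
  rw [alternatingSum, Finset.sum_insert hmF, alternatingSign, h1, alternatingSum, add_comm]
  congr 1
  exact Finset.sum_congr rfl fun v hv => by rw [h2 v hv]

/-- For an initial segment `P`, the later elements have all of the segment below them. It serves to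
separate the nodes left and right of `z`. -/
lemma alternatingSum_split (φ : Fin n → ℝ) (P : Fin n → Prop) [DecidablePred P]
    (hP : ∀ v w, P w → v < w → P v) :
    alternatingSum F φ = alternatingSum (F.filter P) φ +
      (-1) ^ (F.filter P).card * alternatingSum (F.filter fun v => ¬ P v) φ := by
  rw [alternatingSum, ← Finset.sum_filter_add_sum_filter_not F P, alternatingSum, alternatingSum,
    Finset.mul_sum]
  congr 1
  · refine Finset.sum_congr rfl fun v hv => ?_
    rw [alternatingSign, alternatingSign, Finset.filter_filter]
    congr 3
    ext w
    simp only [Finset.mem_filter]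
    have := hP w v (Finset.mem_filter.1 hv).2
    tauto
  · refine Finset.sum_congr rfl fun v hv => ?_
    have hv' := (Finset.mem_filter.1 hv).2
    rw [alternatingSign, alternatingSign, ← mul_assoc, ← pow_add,
      ← Finset.card_filter_add_card_filter_not (s := F.filter (· < v)) P]
    congr 3
    · congr 1
      ext w
      simp only [Finset.mem_filter]
      constructor
      · tauto
      · rintro ⟨h1, h2⟩
        refine ⟨⟨h1, ?_⟩, h2⟩
        rcases lt_trichotomy w v with h | rfl | h
        · exact h
        · exact absurd h2 hv'
        · exact absurd (hP v w h2 h) hv'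
    · congr 1
      ext w
      simp only [Finset.mem_filter]
      tauto

end Alternating

/-! ### Alternating sums of reciprocals -/

section Reciprocals

variable {ι : Type*} [LinearOrder ι] {S : Finset ι → ℝ} {r : ι → ℝ} {δ A : ℝ}

/-- An alternating sum of reciprocals, the leading term of which is the one with the smallest
index, is nonnegative and at most its leading term. -/
lemma alternating_reciprocals_bounds (h0 : S ∅ = 0)
    (hins : ∀ m F, (∀ v ∈ F, m < v) → S (insert m F) = 1 / r m - S F) (hδ : 0 < δ)
    (F : Finset ι) (hr : ∀ v ∈ F, 0 < r v) (hgap : ∀ v ∈ F, ∀ w ∈ F, v < w → r v + δ ≤ r w) :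
    0 ≤ S F ∧ ∀ c > 0, (∀ v ∈ F, c ≤ r v) → S F ≤ 1 / c := by
  induction F using Finset.induction_on_min with
  | empty => simpa [h0] using fun c hc => le_of_lt hc
  | insert m F hm ih =>
    obtain ⟨h1, h2⟩ := ih (fun v hv => hr v (Finset.mem_insert_of_mem hv))
      (fun v hv w hw => hgap v (Finset.mem_insert_of_mem hv) w (Finset.mem_insert_of_mem hw))
    have hm' := Finset.mem_insert_self m F
    have h3 := h2 (r m) (hr m hm') fun v hv => by
      have := hgap m hm' v (Finset.mem_insert_of_mem hv) (hm v hv)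
      linarith
    rw [hins m F hm]
    refine ⟨by linarith, fun c hc hcr => ?_⟩
    have := one_div_le_one_div_of_le hc (hcr m hm')
    linarith

/-- After the leading term at most `1 / (r m + δ)` is subtracted, and `1 / r - 1 / (r + δ)`
decreases in `r`. The abstract `S` and index order allow use on both sides of `z`, with the order
reversed on the left. -/
lemma le_alternating_reciprocals (h0 : S ∅ = 0)
    (hins : ∀ m F, (∀ v ∈ F, m < v) → S (insert m F) = 1 / r m - S F) (hδ : 0 < δ)
    (F : Finset ι) (hr : ∀ v ∈ F, 0 < r v) (hgap : ∀ v ∈ F, ∀ w ∈ F, v < w → r v + δ ≤ r w)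
    {v : ι} (hv : v ∈ F) (hvA : r v ≤ A) : δ / (A * (A + δ)) ≤ S F := by
  set m := F.min' ⟨v, hv⟩
  have hmF : m ∈ F := F.min'_mem _
  have hmr : r m ≤ A := by
    rcases (F.min'_le v hv).eq_or_lt with h | h
    · rw [show m = v from h]; exact hvA
    · have := hgap m hmF v hv h
      linarith
  have hlt : ∀ w ∈ F.erase m, m < w := fun w hw =>
    lt_of_le_of_ne (F.min'_le w (Finset.mem_of_mem_erase hw)) (Finset.ne_of_mem_erase hw).symm
  have hpos := hr m hmF
  have h1 := (alternating_reciprocals_bounds h0 hins hδ (F.erase m)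
    (fun w hw => hr w (Finset.mem_of_mem_erase hw))
    (fun w hw w' hw' => hgap w (Finset.mem_of_mem_erase hw) w'
      (Finset.mem_of_mem_erase hw'))).2 (r m + δ) (by linarith)
    fun w hw => hgap m hmF w (Finset.mem_of_mem_erase hw) (hlt w hw)
  rw [← Finset.insert_erase hmF, hins m _ hlt]
  have h2 : 1 / r m - 1 / (r m + δ) = δ / (r m * (r m + δ)) := by
    field_simp; ring
  have hA : 0 ≤ A := by linarith
  have h3 : δ / (A * (A + δ)) ≤ δ / (r m * (r m + δ)) := by gcongr
  linarith

end Reciprocals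

/-! ### Denominator and numerator of the error of Berrut's interpolant -/

section Denominator

variable {n : ℕ} {t : Fin n → ℝ} {F : Finset (Fin n)} {z δ A : ℝ}

/-- Lower bound for the denominator of Berrut's interpolant. -/
lemma le_abs_sum_alternatingSign_div (ht : StrictMono t) (hδ : 0 < δ)
    (hgap : ∀ v w, v < w → δ ≤ t w - t v) (hz : ∀ v ∈ F, t v ≠ z) {v : Fin n} (hv : v ∈ F)
    (hA : |z - t v| ≤ A) :
    δ / (A * (A + δ)) ≤ |∑ v ∈ F, alternatingSign F v / (z - t v)| := by
  classical
  have hsum : ∑ v ∈ F, alternatingSign F v / (z - t v) =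
      alternatingSum F fun v => 1 / (z - t v) :=
    Finset.sum_congr rfl fun v _ => by rw [div_eq_mul_one_div]
  set F₁ := F.filter fun v => t v < z
  set F₂ := F.filter fun v => ¬ t v < z
  -- `T` and `S` are the contributions from the left and right of `z`, normalised so that the node
  -- nearest to `z` counts positively. On the left this is the largest node, hence the dual order
  -- and the factor `(-1) ^ card`.
  let T : Finset (Fin n)ᵒᵈ → ℝ := fun G =>
    -((-1) ^ Finset.card (α := Fin n) G * alternatingSum (n := n) G fun v => 1 / (z - t v))
  let S : Finset (Fin n) → ℝ := fun G => -alternatingSum G fun v => 1 / (z - t v)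
  have hT0 : T ∅ = 0 := by
    have h : T ∅ = -((-1) ^ (∅ : Finset (Fin n)).card *
      alternatingSum (∅ : Finset (Fin n)) fun v => 1 / (z - t v)) := rfl
    rw [h]
    simp [alternatingSum]
  have hS0 : S ∅ = 0 := by simp [S, alternatingSum]
  have hTins : ∀ (m : (Fin n)ᵒᵈ) (G : Finset (Fin n)ᵒᵈ), (∀ v ∈ G, m < v) →
      T (insert m G) = 1 / (z - t (OrderDual.ofDual m)) - T G := by
    intro m G hm
    have hsq : ((-1 : ℝ) ^ Finset.card (α := Fin n) G) * (-1) ^ Finset.card (α := Fin n) G = 1 := by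
      rw [← mul_pow]; norm_num
    have hmG : m ∉ G := fun h => lt_irrefl _ (hm m h)
    have h1 := alternatingSum_insert_max (n := n) (F := G) (m := OrderDual.ofDual m)
      (fun v hv => hm v hv) fun v => 1 / (z - t v)
    have h2 : Finset.card (α := Fin n) (insert (OrderDual.ofDual m) G) =
      Finset.card (α := Fin n) G + 1 := Finset.card_insert_of_notMem hmG
    have h3 : T (insert m G) = -((-1) ^ Finset.card (α := Fin n) (insert (OrderDual.ofDual m) G) *
      alternatingSum (n := n) (insert (OrderDual.ofDual m) G) fun v => 1 / (z - t v)) := by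
      simp only [T]
      congr!
    rw [h3, h1, h2, pow_succ]
    simp only [T]
    linear_combination (1 / (z - t (OrderDual.ofDual m))) * hsq
  have hSins : ∀ (m : Fin n) (G : Finset (Fin n)), (∀ v ∈ G, m < v) →
      S (insert m G) = 1 / (t m - z) - S G := by
    intro m G hm
    simp only [S]
    rw [alternatingSum_insert_min hm, ← neg_sub z (t m), one_div_neg_eq_neg_one_div]
    ring
  have hT1 : ∀ v ∈ F₁, 0 < z - t v := fun v hv => sub_pos.2 (Finset.mem_filter.1 hv).2
  have hS1 : ∀ v ∈ F₂, 0 < t v - z := fun v hv => by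
    have := Finset.mem_filter.1 hv
    exact sub_pos.2 (lt_of_le_of_ne (not_lt.1 this.2) (hz v this.1).symm)
  have hTg : ∀ v ∈ F₁, ∀ w ∈ F₁, w < v → z - t v + δ ≤ z - t w := fun v _ w _ h => by
    linarith [hgap w v h]
  have hSg : ∀ v ∈ F₂, ∀ w ∈ F₂, v < w → t v - z + δ ≤ t w - z := fun v _ w _ h => by
    linarith [hgap v w h]
  have hTn : 0 ≤ T F₁ := (alternating_reciprocals_bounds (ι := (Fin n)ᵒᵈ)
    (r := fun v => z - t (OrderDual.ofDual v)) hT0 hTins hδ F₁ hT1 hTg).1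
  have hSn : 0 ≤ S F₂ := (alternating_reciprocals_bounds hS0 hSins hδ F₂ hS1 hSg).1
  -- No cancellation between the sides: crossing `z` changes both the alternating sign and the sign
  -- of `z - t v`.
  have hD : |∑ v ∈ F, alternatingSign F v / (z - t v)| = T F₁ + S F₂ := by
    have hsplit := alternatingSum_split (F := F) (fun v => 1 / (z - t v)) (fun v => t v < z)
      fun v w hw hvw => (ht hvw).trans hw
    rw [hsum, hsplit]
    have hsq : ((-1 : ℝ) ^ F₁.card) * (-1) ^ F₁.card = 1 := by rw [← mul_pow]; norm_num
    have : alternatingSum F₁ (fun v => 1 / (z - t v)) + (-1) ^ F₁.card *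
        alternatingSum F₂ (fun v => 1 / (z - t v)) = -(-1) ^ F₁.card * (T F₁ + S F₂) := by
      simp only [T, S]
      linear_combination (-alternatingSum F₁ fun v => 1 / (z - t v)) * hsq
    rw [this, abs_mul, abs_of_nonneg (add_nonneg hTn hSn)]
    simp
  rw [hD]
  rcases lt_or_gt_of_ne (hz v hv) with h | h
  · have hvF : v ∈ F₁ := Finset.mem_filter.2 ⟨hv, h⟩
    have := le_alternating_reciprocals (ι := (Fin n)ᵒᵈ) (A := A)
      (r := fun v => z - t (OrderDual.ofDual v)) hT0 hTins hδ F₁ hT1 hTg (v := v) hvF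
      ((le_abs_self _).trans hA)
    linarith
  · have hvF : v ∈ F₂ := Finset.mem_filter.2 ⟨hv, h.not_gt⟩
    have := le_alternating_reciprocals (A := A) hS0 hSins hδ F₂ hS1 hSg hvF
      (by rw [abs_sub_comm] at hA; exact (le_abs_self _).trans hA)
    linarith

/-- Bound for the alternating sum of the values of a bounded Lipschitz function at increasing
points. -/
lemma abs_alternatingSum_le {Φ : ℝ → ℝ} {C M : ℝ} (ht : StrictMono t)
    (htΩ : ∀ v, t v ∈ Set.Icc (-1 : ℝ) 1)
    (hC : ∀ s ∈ Set.Icc (-1 : ℝ) 1, |Φ s| ≤ C)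
    (hM : ∀ s ∈ Set.Icc (-1 : ℝ) 1, ∀ s' ∈ Set.Icc (-1 : ℝ) 1, |Φ s - Φ s'| ≤ M * |s - s'|)
    (F : Finset (Fin n)) : |alternatingSum F fun v => Φ (t v)| ≤ C + M := by
  have hM0 : 0 ≤ M := by
    have h := (abs_nonneg _).trans (hM 1 (by simp) 0 (by simp))
    simpa using h
  -- Doubling makes the sum telescope: if `s` is the sum without its first node `m`, then `2 (Φ (t
  -- m) - s) - Φ τ = (Φ (t m) - Φ τ) - (2 s - Φ (t m))`, so the Lipschitz terms add up to `M (1 -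
  -- τ)`.
  have key : ∀ τ ∈ Set.Icc (-1 : ℝ) 1, (∀ v ∈ F, τ ≤ t v) →
      |2 * (alternatingSum F fun v => Φ (t v)) - Φ τ| ≤ C + M * (1 - τ) := by
    induction F using Finset.induction_on_min with
    | empty =>
      intro τ hτ _
      have h1 := hC τ hτ
      have h2 : 0 ≤ M * (1 - τ) := mul_nonneg hM0 (by linarith [hτ.2])
      simpa [alternatingSum] using h1.trans (le_add_of_nonneg_right h2)
    | insert m F hm ih =>
      intro τ hτ hle
      rw [alternatingSum_insert_min hm]
      have h1 := ih (t m) (htΩ m) fun v hv => (ht (hm v hv)).le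
      have h2 := hle m (Finset.mem_insert_self m F)
      have h3 := hM (t m) (htΩ m) τ hτ
      rw [abs_of_nonneg (sub_nonneg.2 h2)] at h3
      rw [abs_le] at h1 h3 ⊢
      constructor <;> linarith [h1.1, h1.2, h3.1, h3.2]
  have h1 := key (-1) (by simp) fun v _ => (htΩ v).1
  have h2 := hC (-1) (by simp)
  rw [abs_le] at h1 h2 ⊢
  constructor <;> linarith [h1.1, h1.2, h2.1, h2.2]

end Denominator

/-- The divided difference `t ↦ (g z - g t) / (z - t)` extends to a bounded Lipschitz function,
uniformly in `z`. -/
lemma exists_dividedDifference {g : ℝ → ℝ} (hg : ContDiff ℝ 2 g) :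
    ∃ C M : ℝ, ∀ z ∈ Set.Icc (-1 : ℝ) 1, ∃ Φ : ℝ → ℝ,
      (∀ t ∈ Set.Icc (-1 : ℝ) 1, |Φ t| ≤ C) ∧
      (∀ t ∈ Set.Icc (-1 : ℝ) 1, ∀ t' ∈ Set.Icc (-1 : ℝ) 1, |Φ t - Φ t'| ≤ M * |t - t'|) ∧
      ∀ t, Φ t * (z - t) = g z - g t := by
  have hgd : Differentiable ℝ g := hg.differentiable (by norm_num)
  have hg' : ContDiff ℝ 1 (deriv g) := ((contDiff_succ_iff_deriv (n := 1)).1 hg).2.2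
  have hgd' : Differentiable ℝ (deriv g) := hg'.differentiable (by norm_num)
  have hgc := hg'.continuous
  obtain ⟨C, hC⟩ := isCompact_Icc.exists_bound_of_continuousOn (s := Set.Icc (-1 : ℝ) 1)
    hgc.continuousOn
  obtain ⟨M, hM⟩ := isCompact_Icc.exists_bound_of_continuousOn (s := Set.Icc (-1 : ℝ) 1)
    (hg'.continuous_deriv le_rfl).continuousOn
  have hM0 : 0 ≤ M := (norm_nonneg _).trans (hM 0 (by simp))
  have hlip : ∀ a ∈ Set.Icc (-1 : ℝ) 1, ∀ b ∈ Set.Icc (-1 : ℝ) 1,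
      |deriv g a - deriv g b| ≤ M * |a - b| := fun a ha b hb =>
    (convex_Icc (-1 : ℝ) 1).norm_image_sub_le_of_norm_deriv_le (fun x _ => hgd' x) hM hb ha
  have hcont : ∀ z t : ℝ, Continuous fun s => deriv g (t + s * (z - t)) := fun z t => by fun_prop
  have hmem : ∀ z ∈ Set.Icc (-1 : ℝ) 1, ∀ t ∈ Set.Icc (-1 : ℝ) 1, ∀ s ∈ Set.uIoc (0 : ℝ) 1,
      t + s * (z - t) ∈ Set.Icc (-1 : ℝ) 1 := by
    intro z hz t ht s hs
    rw [Set.uIoc_of_le zero_le_one] at hs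
    have := convex_Icc (-1 : ℝ) 1 ht hz (sub_nonneg.2 hs.2) hs.1.le (by ring)
    simp only [smul_eq_mul] at this
    convert this using 1
    ring
  -- Hadamard's formula has no singularity at `t = z` and inherits its bounds from those of `g'` and
  -- `g''`.
  refine ⟨C, M, fun z hz => ⟨fun t => ∫ s in (0 : ℝ)..1, deriv g (t + s * (z - t)), ?_, ?_, ?_⟩⟩
  · intro t ht
    have := intervalIntegral.norm_integral_le_of_norm_le_const (a := (0 : ℝ)) (b := 1) (C := C)
      (f := fun s => deriv g (t + s * (z - t))) fun s hs => hC _ (hmem z hz t ht s hs)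
    simpa using this
  · intro t ht t' ht'
    rw [← intervalIntegral.integral_sub ((hcont z t).intervalIntegrable _ _)
      ((hcont z t').intervalIntegrable _ _)]
    have := intervalIntegral.norm_integral_le_of_norm_le_const (a := (0 : ℝ)) (b := 1)
      (C := M * |t - t'|)
      (f := fun s => deriv g (t + s * (z - t)) - deriv g (t' + s * (z - t'))) fun s hs => by
        refine (hlip _ (hmem z hz t ht s hs) _ (hmem z hz t' ht' s hs)).trans ?_
        rw [Set.uIoc_of_le zero_le_one] at hs
        have : t + s * (z - t) - (t' + s * (z - t')) = (1 - s) * (t - t') := by ring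
        rw [this, abs_mul, abs_of_nonneg (sub_nonneg.2 hs.2)]
        gcongr
        exact mul_le_of_le_one_left (abs_nonneg _) (by linarith [hs.1])
    simpa using this
  · intro t
    have h := intervalIntegral.integral_eq_sub_of_hasDerivAt (a := (0 : ℝ)) (b := 1)
      (f := fun s => g (t + s * (z - t))) (f' := fun s => deriv g (t + s * (z - t)) * (z - t))
      (fun s _ => by
        have h1 : HasDerivAt (fun s : ℝ => t + s * (z - t)) (z - t) s := by
          simpa using ((hasDerivAt_id s).mul_const (z - t)).const_add t
        exact (hgd _).hasDerivAt.comp s h1)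
      (((hcont z t).mul continuous_const).intervalIntegrable _ _)
    rw [intervalIntegral.integral_mul_const] at h
    rw [h]; simp

/-! ### Berrut's interpolant -/

section Berrut

variable {n : ℕ} {t y : Fin n → ℝ} {F : Finset (Fin n)} {z : ℝ}

lemma berrut_node (ht : Function.Injective t) {v : Fin n} (hv : v ∈ F) :
    berrut t y F (t v) = y v := by
  have h : ∃ w ∈ F, t w = t v := ⟨v, hv, rfl⟩
  rw [berrut, dif_pos h, ht h.choose_spec.2]

lemma berrut_of_ne (hz : ∀ v ∈ F, t v ≠ z) :
    berrut t y F z = (∑ v ∈ F, alternatingSign F v / (z - t v) * y v) /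
      ∑ v ∈ F, alternatingSign F v / (z - t v) := by
  rw [berrut, dif_neg]
  push Not
  exact hz

lemma berrut_empty (z : ℝ) : berrut t y ∅ z = 0 := by
  -- The quotient is `0 / 0 = 0`, in accordance with the convention for no responses.
  rw [berrut_of_ne (by simp)]; simp

lemma exists_gap (ht : StrictMono t) : ∃ δ > 0, ∀ v w, v < w → δ ≤ t w - t v := by
  let s : Finset (Fin n × Fin n) := Finset.univ.filter fun q => q.1 < q.2
  rcases s.eq_empty_or_nonempty with hs | hs
  · refine ⟨1, one_pos, fun v w hvw => ?_⟩
    have : (v, w) ∈ s := Finset.mem_filter.2 ⟨Finset.mem_univ _, hvw⟩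
    simp [hs] at this
  · obtain ⟨q, hq, hmin⟩ := s.exists_min_image (fun q => t q.2 - t q.1) hs
    exact ⟨t q.2 - t q.1, sub_pos.2 (ht (Finset.mem_filter.1 hq).2), fun v w hvw =>
      hmin (v, w) (Finset.mem_filter.2 ⟨Finset.mem_univ _, hvw⟩)⟩

/-- The lower bound for the denominator, with `A` the exact distance to a node, is positive:
Berrut's interpolant has no real poles. -/
lemma sum_alternatingSign_div_ne_zero (ht : StrictMono t) (hF : F.Nonempty)
    (hz : ∀ v ∈ F, t v ≠ z) : ∑ v ∈ F, alternatingSign F v / (z - t v) ≠ 0 := by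
  obtain ⟨δ, hδ, hgap⟩ := exists_gap ht
  obtain ⟨v, hv⟩ := hF
  have hpos : 0 < |z - t v| := abs_pos.2 (sub_ne_zero.2 (hz v hv).symm)
  have := le_abs_sum_alternatingSign_div ht hδ hgap hz hv le_rfl
  exact abs_pos.1 (lt_of_lt_of_le (by positivity) this)

/-- Berrut's interpolant, written as a quotient of polynomials. -/
lemma berrut_eq_prod_div (ht : StrictMono t) (hF : F.Nonempty) (z : ℝ) :
    ∑ v ∈ F, alternatingSign F v * ∏ w ∈ F.erase v, (z - t w) ≠ 0 ∧
      berrut t y F z = (∑ v ∈ F, alternatingSign F v * (∏ w ∈ F.erase v, (z - t w)) * y v) /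
        ∑ v ∈ F, alternatingSign F v * ∏ w ∈ F.erase v, (z - t w) := by
  by_cases hz : ∃ v ∈ F, t v = z
  · obtain ⟨v, hv, rfl⟩ := hz
    have hzero : ∀ w ∈ F, w ≠ v → ∏ u ∈ F.erase w, (t v - t u) = 0 := fun w _ hwv =>
      Finset.prod_eq_zero (Finset.mem_erase.2 ⟨hwv.symm, hv⟩) (sub_self _)
    rw [berrut_node ht.injective hv, Finset.sum_eq_single_of_mem v hv fun w hw hwv => by
        rw [hzero w hw hwv, mul_zero],
      Finset.sum_eq_single_of_mem v hv fun w hw hwv => by rw [hzero w hw hwv]; ring]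
    have h1 : alternatingSign F v * ∏ w ∈ F.erase v, (t v - t w) ≠ 0 := by
      refine mul_ne_zero (fun h => by simpa [h] using abs_alternatingSign F v)
        (Finset.prod_ne_zero_iff.2 fun w hw => ?_)
      exact sub_ne_zero.2 fun h => (Finset.mem_erase.1 hw).1 (ht.injective h).symm
    exact ⟨h1, (mul_div_cancel_left₀ _ h1).symm⟩
  · push Not at hz
    have hP : ∏ w ∈ F, (z - t w) ≠ 0 :=
      Finset.prod_ne_zero_iff.2 fun w hw => sub_ne_zero.2 (hz w hw).symm
    have hterm : ∀ v ∈ F, alternatingSign F v * ∏ w ∈ F.erase v, (z - t w) =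
        alternatingSign F v / (z - t v) * ∏ w ∈ F, (z - t w) := fun v hv => by
      have hv0 : z - t v ≠ 0 := sub_ne_zero.2 (hz v hv).symm
      rw [← Finset.mul_prod_erase F _ hv]
      field_simp
    have hD : ∑ v ∈ F, alternatingSign F v * ∏ w ∈ F.erase v, (z - t w) =
        (∑ v ∈ F, alternatingSign F v / (z - t v)) * ∏ w ∈ F, (z - t w) := by
      rw [Finset.sum_mul]; exact Finset.sum_congr rfl hterm
    have hNum : ∑ v ∈ F, alternatingSign F v * (∏ w ∈ F.erase v, (z - t w)) * y v =
        (∑ v ∈ F, alternatingSign F v / (z - t v) * y v) * ∏ w ∈ F, (z - t w) := by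
      rw [Finset.sum_mul]
      exact Finset.sum_congr rfl fun v hv => by rw [hterm v hv]; ring
    rw [hD, hNum, berrut_of_ne hz, mul_div_mul_right _ _ hP]
    exact ⟨mul_ne_zero (sum_alternatingSign_div_ne_zero ht hF hz) hP, rfl⟩

/-- The polynomial form is valid at the nodes too. This makes `f ∘ baccEncoder α x` of class `C²`.
-/
lemma contDiff_berrut (ht : StrictMono t) (hF : F.Nonempty) : ContDiff ℝ 2 (berrut t y F) := by
  rw [funext fun z => (berrut_eq_prod_div (y := y) ht hF z).2]
  refine ContDiff.div ?_ ?_ fun z => (berrut_eq_prod_div (y := y) ht hF z).1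
  · exact ContDiff.sum fun v _ => (contDiff_const.mul (contDiff_prod fun w _ =>
      contDiff_id.sub contDiff_const)).mul contDiff_const
  · exact ContDiff.sum fun v _ => contDiff_const.mul (contDiff_prod fun w _ =>
      contDiff_id.sub contDiff_const)

end Berrut

/-- The error of Berrut's interpolant of a `C²` function at a point at distance at most `A` from a
node, when distinct nodes have distance at least `δ`. -/
lemma exists_berrut_error_le {g : ℝ → ℝ} (hg : ContDiff ℝ 2 g) :
    ∃ C ≥ 0, ∀ {n : ℕ} {t : Fin n → ℝ} {F : Finset (Fin n)} {z δ A : ℝ}, StrictMono t →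
      (∀ v, t v ∈ Omega) → z ∈ Omega → 0 < δ → (∀ v w, v < w → δ ≤ t w - t v) → 0 < A →
      (∃ v ∈ F, |z - t v| ≤ A) →
      |berrut t (fun v => g (t v)) F z - g z| ≤ C * (A * (A + δ) / δ) := by
  obtain ⟨C, M, hCM⟩ := exists_dividedDifference hg
  have hC0 : 0 ≤ C := by
    obtain ⟨Φ, h1, -⟩ := hCM 0 (by simp)
    exact (abs_nonneg _).trans (h1 0 (by simp))
  have hM0 : 0 ≤ M := by
    obtain ⟨Φ, -, h2, -⟩ := hCM 0 (by simp)
    simpa using (abs_nonneg _).trans (h2 1 (by simp) 0 (by simp))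
  refine ⟨C + M, add_nonneg hC0 hM0, ?_⟩
  intro n t F z δ A ht htΩ hz hδ hgap hA hex
  by_cases hnode : ∃ v ∈ F, t v = z
  · obtain ⟨v, hv, rfl⟩ := hnode
    rw [berrut_node ht.injective hv, sub_self, abs_zero]
    positivity
  push Not at hnode
  obtain ⟨v, hv, hvA⟩ := hex
  obtain ⟨Φ, hΦ1, hΦ2, hΦ3⟩ := hCM z (Set.Ioo_subset_Icc_self hz)
  have hden := le_abs_sum_alternatingSign_div ht hδ hgap hnode hv hvA
  have hnum := abs_alternatingSum_le ht (fun v => Set.Ioo_subset_Icc_self (htΩ v)) hΦ1 hΦ2 F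
  rw [berrut_of_ne hnode]
  set D := ∑ v ∈ F, alternatingSign F v / (z - t v)
  have hD : D ≠ 0 := sum_alternatingSign_div_ne_zero ht ⟨v, hv⟩ hnode
  -- Moving `g z` into the sum turns each term into a divided difference, which cancels the pole at
  -- the node.
  have heq : (∑ v ∈ F, alternatingSign F v / (z - t v) * g (t v)) / D - g z =
      -(alternatingSum F fun v => Φ (t v)) / D := by
    rw [div_sub' hD]
    congr 1
    rw [Finset.sum_mul, ← Finset.sum_sub_distrib, alternatingSum, ← Finset.sum_neg_distrib]
    refine Finset.sum_congr rfl fun v hv => ?_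
    have hne : z - t v ≠ 0 := sub_ne_zero.2 (hnode v hv).symm
    have := hΦ3 (t v)
    field_simp
    linear_combination alternatingSign F v * this
  rw [heq, abs_div, abs_neg, div_eq_mul_inv]
  have hinv : |D|⁻¹ ≤ A * (A + δ) / δ := by
    rw [← inv_div]
    exact inv_anti₀ (by positivity) hden
  gcongr

/-! ### The BACC decoder -/

section Bacc

variable {p : ℝ} {K : ℕ} {x α : Fin K → ℝ} {β : (N : ℕ) → Fin N → ℝ} {B : ℝ} {f : ℝ → ℝ}

theorem bacc_convergence (hp0 : 0 < p) (hp1 : p < 1) (hK : 0 < K) (hα : StrictMono α)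
    (hαΩ : ∀ k, α k ∈ Omega) (hβ : ∀ N, StrictMono (β N)) (hβΩ : ∀ N n, β N n ∈ Omega)
    (hB : 0 < B) (hβB : ∀ N, 2 ≤ N → deltaMax (β N) / deltaMin (β N) ≤ B)
    (hf : ContDiff ℝ 2 f) :
    ConvergesWithHighProbability p
        (fun N F => approxError α x f (baccDecoder f (baccEncoder α x) (β N) F))
        (fun N => Real.logb (1 / p) N ^ 4 / (N : ℝ) ^ 2) ∧
      ConvergesInMean p
        (fun N F => approxError α x f (baccDecoder f (baccEncoder α x) (β N) F))
        (fun N => Real.logb (1 / p) N ^ 4 / (N : ℝ) ^ 2) := by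
  have hg : ContDiff ℝ 2 (f ∘ baccEncoder α x) :=
    hf.comp (contDiff_berrut hα ⟨⟨0, hK⟩, Finset.mem_univ _⟩)
  have henc : ∀ k, baccEncoder α x (α k) = x k := fun k =>
    berrut_node hα.injective (Finset.mem_univ k)
  obtain ⟨C, hC, herr⟩ := exists_berrut_error_le hg
  have hgap : ∀ N, 2 ≤ N → ∀ v w, v < w → 1 / (B * N) ≤ β N w - β N v := fun N hN v w hvw =>
    (div_le_deltaMin (hβ N) (hβΩ N) hN hB (hβB N hN)).trans (deltaMin_le_sub (hβ N) (hβΩ N) hvw)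
  have hsq : ∀ N (F : Finset (Fin N)) k c,
      |berrut (β N) (fun v => (f ∘ baccEncoder α x) (β N v)) F (α k) -
        (f ∘ baccEncoder α x) (α k)| ≤ c →
      (baccDecoder f (baccEncoder α x) (β N) F (α k) - f (x k)) ^ 2 ≤ c ^ 2 := by
    intro N F k c h
    simp only [Function.comp_apply, henc k] at h
    rw [← sq_abs]
    exact pow_le_pow_left₀ (abs_nonneg _) h 2
  have hgood : ∀ᶠ N in atTop, ∀ F : Finset (Fin N), HitsWindows (windowLength p N) F →
      approxError α x f (baccDecoder f (baccEncoder α x) (β N) F) ≤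
        (C * (28 * B * (28 * B + 1 / B) * B)) ^ 2 *
          (Real.logb (1 / p) N ^ 4 / (N : ℝ) ^ 2) := by
    filter_upwards [eventually_exists_neighbours hp0 hp1 hαΩ hβ hβΩ hB hβB,
      (tendsto_logb_natCast hp0 hp1).eventually_ge_atTop 1, eventually_ge_atTop 2]
      with N hnb hlog hN F hF
    have hN' : (2 : ℝ) ≤ N := by exact_mod_cast hN
    refine approxError_le hK fun k => ?_
    obtain ⟨v, hv, -, -, hvk, -, hdv, -⟩ := hnb F hF k
    have h := herr (F := F) (z := α k) (hβ N) (hβΩ N) (hαΩ k) (δ := 1 / (B * N)) (by positivity)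
      (hgap N hN) (A := 28 * B * (Real.logb (1 / p) N / N)) (by positivity)
      ⟨v, hv, by rwa [abs_of_nonneg (sub_nonneg.2 hvk)]⟩
    refine (hsq N F k _ h).trans ?_
    set ℓ := Real.logb (1 / p) N
    -- `A (A + δ) / δ` with `A` of order `ℓ / N` and `δ = 1 / (B N)`; as `ℓ ≥ 1`, `δ` is itself
    -- dominated by a multiple of `ℓ / N`.
    have h1 : 28 * B * (ℓ / N) * (28 * B * (ℓ / N) + 1 / (B * N)) / (1 / (B * N)) ≤
        28 * B * (28 * B + 1 / B) * B * (ℓ ^ 2 / N) := by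
      have h2 : 1 / (B * N) ≤ 1 / B * (ℓ / N) := by
        rw [one_div_mul_eq_div, div_div, mul_comm (N : ℝ) B]
        gcongr
      calc 28 * B * (ℓ / N) * (28 * B * (ℓ / N) + 1 / (B * N)) / (1 / (B * N))
          ≤ 28 * B * (ℓ / N) * (28 * B * (ℓ / N) + 1 / B * (ℓ / N)) / (1 / (B * N)) := by gcongr
        _ = _ := by field_simp
    calc (C * (28 * B * (ℓ / N) * (28 * B * (ℓ / N) + 1 / (B * N)) / (1 / (B * N)))) ^ 2
        ≤ (C * (28 * B * (28 * B + 1 / B) * B * (ℓ ^ 2 / N))) ^ 2 := by gcongr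
      _ = _ := by ring
  have hrate := tendsto_logb_pow_div_pow hp0 hp1 4 (b := 2) (by norm_num)
  refine ⟨convergesWithHighProbability_of_hitsWindows hp0 hp1 hrate hgood, ?_⟩
  set C₁ := (C * (4 * B + 2)) ^ 2
  set C₂ := ∑ k, f (x k) ^ 2
  have hC₁ : 0 ≤ C₁ := sq_nonneg _
  have hC₂ : 0 ≤ C₂ := Finset.sum_nonneg fun _ _ => sq_nonneg _
  refine convergesInMean_of_hitsWindows hp0 hp1 hrate ?_ (fun N F => approxError_nonneg _ _ _ _)
    (add_nonneg hC₁ hC₂) hgood ?_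
  · filter_upwards [(tendsto_logb_natCast hp0 hp1).eventually_ge_atTop 1,
      eventually_ge_atTop 1] with N hlog hN
    have hN' : (1 : ℝ) ≤ N := by exact_mod_cast hN
    gcongr
    · exact one_le_pow₀ hlog
    · norm_num
  · filter_upwards [eventually_ge_atTop 2] with N hN F
    have hN' : (2 : ℝ) ≤ N := by exact_mod_cast hN
    refine approxError_le hK fun k => ?_
    rcases F.eq_empty_or_nonempty with rfl | ⟨v, hv⟩
    · have h1 : (baccDecoder f (baccEncoder α x) (β N) ∅ (α k) - f (x k)) ^ 2 ≤ C₂ := by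
        rw [baccDecoder, berrut_empty, zero_sub, neg_sq]
        exact Finset.single_le_sum (f := fun k => f (x k) ^ 2) (fun _ _ => sq_nonneg _)
          (Finset.mem_univ k)
      have h2 : C₁ + C₂ ≤ (C₁ + C₂) * (N : ℝ) ^ 2 :=
        le_mul_of_one_le_right (add_nonneg hC₁ hC₂) (one_le_pow₀ (by linarith))
      linarith
    · have h := herr (F := F) (z := α k) (hβ N) (hβΩ N) (hαΩ k) (δ := 1 / (B * N))
        (by positivity) (hgap N hN) (A := 2) two_pos ⟨v, hv, by
          rw [abs_le]
          constructor <;> linarith [(hαΩ k).1, (hαΩ k).2, (hβΩ N v).1, (hβΩ N v).2]⟩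
      refine (hsq N F k _ h).trans ?_
      -- For an arbitrary nonempty `F` the only distance available is `A = 2`, the length of `Ω`;
      -- the error may then grow linearly in `N`, and its square like `N ^ 2`.
      have h1 : 2 * (2 + 1 / (B * N)) / (1 / (B * N)) ≤ (4 * B + 2) * N := by
        have : 2 * (2 + 1 / (B * N)) / (1 / (B * N)) = 4 * B * N + 2 := by field_simp; ring
        rw [this]; linarith
      calc (C * (2 * (2 + 1 / (B * N)) / (1 / (B * N)))) ^ 2
          ≤ (C * ((4 * B + 2) * N)) ^ 2 := by gcongr
        _ = C₁ * (N : ℝ) ^ 2 := by simp only [C₁]; ring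
        _ ≤ (C₁ + C₂) * (N : ℝ) ^ 2 := by gcongr; linarith

end Bacc

end CodedComputing

theorem corollary1
    -- straggler probability
    (p : ℝ) (hp0 : 0 < p) (hp1 : p < 1)
    -- data points and encoder mapping points, fixed
    (K : ℕ) (hK : 0 < K) (x α : Fin K → ℝ) (hα : StrictMono α)
    (hαΩ : ∀ k, α k ∈ CodedComputing.Omega)
    -- decoder mapping points, for each number `N` of servers
    (β : (N : ℕ) → Fin N → ℝ) (hβ : ∀ N, StrictMono (β N))
    (hβΩ : ∀ N n, β N n ∈ CodedComputing.Omega)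
    (B : ℝ) (hB : 0 < B)
    (hβB : ∀ N, 2 ≤ N → CodedComputing.deltaMax (β N) / CodedComputing.deltaMin (β N) ≤ B) :
    -- LeTCC
    (∀ (f : ℝ → ℝ) (ν : NNReal) (η : ℝ), LipschitzWith ν f → Differentiable ℝ f →
      Differentiable ℝ (deriv f) → (∀ y, |deriv (deriv f) y| ≤ η) →
      ∀ enc : ℝ → ℝ, CodedComputing.IsNaturalSpline α enc → (∀ k, enc (α k) = x k) →
      ∀ lam : ℕ → ℝ, (∀ N, 1 ≤ N → 0 ≤ lam N ∧ lam N ≤ 1 / (N : ℝ) ^ 4) →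
      ∀ dec : (N : ℕ) → Finset (Fin N) → ℝ → ℝ,
      (∀ N F, F.Nonempty → CodedComputing.IsLetccDecoder f enc (β N) (lam N) F (dec N F)) →
      CodedComputing.ConvergesWithHighProbability p
        (fun N F => CodedComputing.approxError α x f (dec N F))
        (fun N => Real.logb (1 / p) N ^ 3 / (N : ℝ) ^ 3) ∧
      -- with fewer than two responses the minimiser is not unique: the rule that selects it
      -- has to keep the outputs bounded
      ((∃ M : ℝ, ∀ N F, F.card < 2 → ∀ k, |dec N F (α k)| ≤ M) →
        CodedComputing.ConvergesInMean p
          (fun N F => CodedComputing.approxError α x f (dec N F))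
          (fun N => Real.logb (1 / p) N ^ 3 / (N : ℝ) ^ 3))) ∧
    -- BACC
    (∀ f : ℝ → ℝ, ContDiff ℝ 2 f →
      CodedComputing.ConvergesWithHighProbability p
        (fun N F => CodedComputing.approxError α x f
          (CodedComputing.baccDecoder f (CodedComputing.baccEncoder α x) (β N) F))
        (fun N => Real.logb (1 / p) N ^ 4 / (N : ℝ) ^ 2) ∧
      CodedComputing.ConvergesInMean p
        (fun N F => CodedComputing.approxError α x f
          (CodedComputing.baccDecoder f (CodedComputing.baccEncoder α x) (β N) F))
        (fun N => Real.logb (1 / p) N ^ 4 / (N : ℝ) ^ 2)) := by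
  refine ⟨?_, fun f hf =>
    CodedComputing.bacc_convergence hp0 hp1 hK hα hαΩ hβ hβΩ hB hβB hf⟩
  intro f ν η hf hfd hfd' hη enc henc hencα lam hlam dec hdec
  obtain ⟨hg, hg', M, hM⟩ :=
    CodedComputing.comp_bounded_second_deriv hf hfd hfd' hη henc.contDiff
  exact CodedComputing.letcc_convergence hp0 hp1 hK hαΩ hβ hβΩ hB hβB hg hg' hM hencα hlam hdec
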